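/- **Setting.** Let $\mathbb T=\mathbb R/\mathbb Z$ and let $\|v-w\|$ be the flat (Euclidean) distance on $\mathbb T^2$. Let $T(x,y)=(x+a,y+b)$ be a minimal rotation of $\mathbb T^2$ and $z_0\in\mathbb T^2$; put $z_{2n}=T^nz_0$, $z_{2n+1}=T^{-n-1}z_0$, $z_n=(x_n,y_n)$, let $\sigma,\tau:\mathbb N\to\mathbb N$ be the bijections with $Tz_n=z_{\sigma(n)}$, $T^{-1}z_n=z_{\tau(n)}$, and let $X=(\mathbb T\setminus\{x_n:n\in\mathbb N\})\times\mathbb T$. Fix a strictly decreasing sequence $1=\epsilon_0>\epsilon_1>\cdots\to0$, numbers $\epsilon_{k+1}<e^1_k<e^2_k<e^3_k<\epsilon_k$, and a sequence $(q_k)$ dense in $[0,1]$. For $\alpha\in[0,1]^{\mathbb N}$ let $p_\alpha:(0,1]\to[0,\frac14]$ be the continuous function with $p_\alpha(1)=\frac14$; $p_\alpha=q_0/4$ on $[\epsilon_1,e^1_0]$ and $p_\alpha=\alpha(0)/4$ on $[e^2_0,e^3_0]$; for $k\ge1$, $p_\alpha=\alpha(k)/4$ on $[\epsilon_{k+1},e^1_k]$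 and $p_\alpha=q_k/4$ on $[e^2_k,e^3_k]$; and $p_\alpha$ affine on each $[e^1_k,e^2_k]$ and $[e^3_k,\epsilon_k]$. For $0<t\le1$ let $h^\alpha_t:[-1,1]\to[-1,1]$ be the function whose graph is the polyline through $$(-1,-1),\ \left(-\tfrac{1+t}2,-t\right),\ \left(-\tfrac12,-\tfrac t2\right),\ \left(p_\alpha(t),\tfrac t4\right),\ \left(\tfrac12,\tfrac t2\right),\ \left(\tfrac{1+t}2,t\right),\ (1,1),$$ let $h^\alpha_{-t}=h^\alpha_t$, and let $h^\alpha_0$ be given by the polyline through $(-1,-1),(-\frac12,0),(\frac12,0),(1,1)$. For a sequence $\delta_n>0$ let $A_n=\{z_n+(t,s):|t|,|s|\le\delta_n\}$, let $\Lambda_n$ be the identity off $A_n$ and $\Lambda_n(z_n+(t,s))=z_n+\bigl(t,h^\alpha_t((h^\alpha_{\delta_n})^{-1}(s))\bigr)$ on $A_n$, and put $$\Phi_n=\Lambda_n\circ\cdots\circ\Lambda_0,\qquad \Phi^\sigma_n=\Lambda_{\sigma(n)}\circ\cdots\circ\Lambda_{\sigma(0)},\qquad \Phi^\tau_n=\Lambda_{\tau(n)}\circ\cdots\circ\Lambda_{\tau(0)}.$$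 **Theorem.** For every $\alpha\in[0,1]^{\mathbb N}$ there are integers $a_n\ge2$ with $\prod_{n\ge1}(1-1/a_n)>0$ and positive thresholds $\epsilon_{1,n},\epsilon_{2,n},\epsilon_{3,n}$ such that, whenever $\operatorname{Diam}(A_n)<\epsilon_{i,n}$ for all $n$ and $i=1,2,3$, the following hold. 1. If $m>n\ge1$ and $\|v-w\|\ge1/n$, then $\|\Phi_m(v)-\Phi_m(w)\|\ge\prod_{r=n+1}^m(1-1/a_r)\,\|\Phi_n(v)-\Phi_n(w)\|$. 2. $\Phi_n,\Phi^\sigma_n,\Phi^\tau_n$ restrict to bijections of $X$; all maps $(\Phi^\sigma_n)^{-1}\circ T\circ\Phi_n$ and $(\Phi^\tau_n)^{-1}\circ T^{-1}\circ\Phi_n$ are uniformly continuous on $X$, and each of these two sequences is uniformly Cauchy on $X$. 3. $\Phi_n$ converges uniformly to a continuous surjection $\Phi_\alpha:\mathbb T^2\to\mathbb T^2$, which preserves the first coordinate and restricts to a bijection of $X$; the fibre $\Phi_\alpha^{-1}(\{z\})$ fails to be a singleton if and only if $z=z_n$ for some $n$. 4. The map $\Phi_\alpha^{-1}\circ T\circ\Phi_\alpha$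 on $X$ extends uniquely to a homeomorphism $S_\alpha$ of $\mathbb T^2$, and $\Phi_\alpha\circ S_\alpha=T\circ\Phi_\alpha$ on $\mathbb T^2$. On $X$, $S_\alpha$ and $S_\alpha^{-1}$ are the uniform limits of the two sequences in 2. -/

import Mathlib

open Set Filter Topology

noncomputable section

namespace DenjoyRees

/-! ### The torus, rotations, and the enumeration of an orbit -/

/-- The torus `𝕋² = (ℝ/ℤ)²`. -/
abbrev Torus : Type := UnitAddCircle × UnitAddCircle

/-- The usual (flat, Euclidean) distance on the torus. It induces the same uniformity as the
product metric of Mathlib. -/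
def flatDist (v w : Torus) : ℝ := Real.sqrt (dist v.1 w.1 ^ 2 + dist v.2 w.2 ^ 2)

/-- The diameter of a subset of the torus for the flat distance (distances are bounded, so the
supremum is a genuine one for non-empty sets). -/
def flatDiam (A : Set Torus) : ℝ := sSup {r | ∃ v ∈ A, ∃ w ∈ A, r = flatDist v w}

/-- The rotation `T (x, y) = (x + a, y + b)`, where `c = (a, b)`. -/
def rot (c : Torus) : Torus ≃ₜ Torus := Homeomorph.addRight c

/-- A homeomorphism is minimal if each of its (two-sided) orbits is dense. -/
def IsMinimalHomeo (f : Torus ≃ₜ Torus) : Prop :=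
  ∀ w : Torus, Dense (range fun k : ℤ => (f ^ k) w)

/-- The exponents `0, -1, 1, -2, 2, …`. -/
def orbitIndex (n : ℕ) : ℤ := if Even n then ((n / 2 : ℕ) : ℤ) else -(((n + 1) / 2 : ℕ) : ℤ)

/-- `z_{2n} = T^n z₀` and `z_{2n+1} = T^{-n-1} z₀`. -/
def orbitPt (c z₀ : Torus) (n : ℕ) : Torus := (rot c ^ orbitIndex n) z₀

/-- The bijection of `ℕ` with `T z_n = z_{σ n}`. -/
def sigma (n : ℕ) : ℕ := if Even n then n + 2 else if n = 1 then 0 else n - 2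

/-- The bijection of `ℕ` with `T⁻¹ z_n = z_{τ n}`. -/
def tau (n : ℕ) : ℕ := if Even n then (if n = 0 then 1 else n - 2) else n + 2

lemma orbitIndex_sigma (n : ℕ) : orbitIndex (sigma n) = 1 + orbitIndex n := by
  unfold orbitIndex sigma
  grind

lemma orbitIndex_tau (n : ℕ) : orbitIndex (tau n) = -1 + orbitIndex n := by
  unfold orbitIndex tau
  grind

lemma rot_orbitPt (c z₀ : Torus) (n : ℕ) :
    rot c (orbitPt c z₀ n) = orbitPt c z₀ (sigma n) := by
  unfold orbitPt
  rw [orbitIndex_sigma, zpow_add, zpow_one]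
  rfl

lemma rot_symm_orbitPt (c z₀ : Torus) (n : ℕ) :
    (rot c).symm (orbitPt c z₀ n) = orbitPt c z₀ (tau n) := by
  unfold orbitPt
  rw [orbitIndex_tau, zpow_add, zpow_neg, zpow_one]
  rfl

/-- `X = (𝕋 \ {x_n : n ∈ ℕ}) × 𝕋`, where `z_n = (x_n, y_n)`. -/
def goodSet (c z₀ : Torus) : Set Torus := {w | ∀ n, w.1 ≠ (orbitPt c z₀ n).1}

/-- The closed square with centre `z` and side length `2 * δ`. -/
def square (z : Torus) (δ : ℝ) : Set Torus :=
  {w | ∃ t s : ℝ, |t| ≤ δ ∧ |s| ≤ δ ∧ w = (z.1 + (t : UnitAddCircle), z.2 + (s : UnitAddCircle))}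

/-! ### The functions `p_α` and `h^α` -/

/-- The affine function whose graph passes through `(x₀, y₀)` and `(x₁, y₁)`. -/
def seg (x₀ y₀ x₁ y₁ u : ℝ) : ℝ := y₀ + (y₁ - y₀) / (x₁ - x₀) * (u - x₀)

/-- The auxiliary choices that are fixed once and for all: a sequence `1 = ε_0 > ε_1 > …`
tending to `0`, a division `ε_{k+1} < e¹_k < e²_k < e³_k < ε_k` of each interval
`[ε_{k+1}, ε_k]` into four strips, and a sequence `q` that is dense in `[0, 1]`. -/
structure StripData where
  eps : ℕ → ℝ
  eps_zero : eps 0 = 1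
  eps_strictAnti : StrictAnti eps
  eps_tendsto : Tendsto eps atTop (𝓝 0)
  e1 : ℕ → ℝ
  e2 : ℕ → ℝ
  e3 : ℕ → ℝ
  eps_lt_e1 : ∀ k, eps (k + 1) < e1 k
  e1_lt_e2 : ∀ k, e1 k < e2 k
  e2_lt_e3 : ∀ k, e2 k < e3 k
  e3_lt_eps : ∀ k, e3 k < eps k
  q : ℕ → ℝ
  q_mem : ∀ k, q k ∈ Icc (0 : ℝ) 1
  q_dense : Icc (0 : ℝ) 1 ⊆ closure (range q)

variable (D : StripData) (α : ℕ → ℝ)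

/-- The constant value of `p_α` on the first strip `[ε_{k+1}, e¹_k]`. -/
def lowVal (k : ℕ) : ℝ := if k = 0 then D.q 0 / 4 else α k / 4

/-- The constant value of `p_α` on the third strip `[e²_k, e³_k]`. -/
def highVal (k : ℕ) : ℝ := if k = 0 then α 0 / 4 else D.q k / 4

/-- The value of `p_α` at `ε_k`. -/
def topVal (k : ℕ) : ℝ := if k = 0 then 1 / 4 else lowVal D α (k - 1)

/-- `p_α` on `[ε_{k+1}, ε_k]`: constant on the first and the third strip, affine on the second
and the fourth. -/
def stripVal (k : ℕ) (t : ℝ) : ℝ :=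
  if t ≤ D.e1 k then lowVal D α k
  else if t ≤ D.e2 k then seg (D.e1 k) (lowVal D α k) (D.e2 k) (highVal D α k) t
  else if t ≤ D.e3 k then highVal D α k
  else seg (D.e3 k) (highVal D α k) (D.eps k) (topVal D α k) t

open Classical in
/-- The function `p_α` on `(0, 1]`: the `k` that is found is the one with
`ε_{k+1} < t ≤ ε_k`. (The value at `t ≤ 0` is irrelevant.) -/
def pFun (t : ℝ) : ℝ :=
  if h : ∃ k, D.eps (k + 1) < t then stripVal D α (Nat.find h) t else 0

/-- The polyline through `(-1, -1)`, `(-(1+t)/2, -t)`, `(-1/2, -t/2)`, `(p, t/4)`,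
`(1/2, t/2)`, `((1+t)/2, t)`, `(1, 1)`. For `t = 0` this is the polyline through
`(-1, -1)`, `(-1/2, 0)`, `(1/2, 0)`, `(1, 1)`. -/
def polyline (p t u : ℝ) : ℝ :=
  if u ≤ -(1 + t) / 2 then seg (-1) (-1) (-(1 + t) / 2) (-t) u
  else if u ≤ -(1 / 2) then seg (-(1 + t) / 2) (-t) (-(1 / 2)) (-t / 2) u
  else if u ≤ p then seg (-(1 / 2)) (-t / 2) p (t / 4) u
  else if u ≤ 1 / 2 then seg p (t / 4) (1 / 2) (t / 2) u
  else if u ≤ (1 + t) / 2 then seg (1 / 2) (t / 2) ((1 + t) / 2) t u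
  else seg ((1 + t) / 2) t 1 1 u

/-- The map `h^α_t : [-1, 1] → [-1, 1]`, with `h^α_{-t} = h^α_t`. -/
def hMap (t u : ℝ) : ℝ := polyline (pFun D α |t|) |t| u

/-- The inverse of the bijection `h^α_t : [-1, 1] → [-1, 1]`, for `0 < |t| ≤ 1`. -/
def hInv (t : ℝ) : ℝ → ℝ := Function.invFunOn (hMap D α t) (Icc (-1) 1)

/-! ### The maps `Λ` and `Φ` -/

/-- The representative in `[-1/2, 1/2)` of a point of the circle. -/
def rep (θ : UnitAddCircle) : ℝ := (AddCircle.equivIco (1 : ℝ) (-1 / 2) θ : ℝ)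

open Classical in
/-- `Λ (x + t, y + s) = (x + t, y + h^α_t ((h^α_δ)⁻¹ s))` for `|t|, |s| ≤ δ`, where
`z = (x, y)`, and `Λ` is the identity outside the square with centre `z` and side `2 * δ`. -/
def lam (z : Torus) (δ : ℝ) (w : Torus) : Torus :=
  if w ∈ square z δ then
    (w.1, z.2 + ((hMap D α (rep (w.1 - z.1)) (hInv D α δ (rep (w.2 - z.2))) : ℝ) : UnitAddCircle))
  else w

/-- The composition `L n ∘ L (n - 1) ∘ ⋯ ∘ L 0`. -/
def compUpTo (L : ℕ → Torus → Torus) : ℕ → Torus → Torus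
  | 0 => L 0
  | n + 1 => L (n + 1) ∘ compUpTo L n

variable (c z₀ : Torus) (δ : ℕ → ℝ)

/-- `Λ_{α,n}`, supported on the square `A_{α,n}` with centre `z_n` and side `2 * δ n`. -/
def lamSeq (n : ℕ) : Torus → Torus := lam D α (orbitPt c z₀ n) (δ n)

/-- `Φ_{α,n} = Λ_{α,n} ∘ ⋯ ∘ Λ_{α,0}`. -/
def phi (n : ℕ) : Torus → Torus := compUpTo (lamSeq D α c z₀ δ) n

/-- `Φ^σ_{α,n} = Λ_{α,σ(n)} ∘ ⋯ ∘ Λ_{α,σ(0)}`. -/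
def phiSigma (n : ℕ) : Torus → Torus := compUpTo (fun k => lamSeq D α c z₀ δ (sigma k)) n

/-- `Φ^τ_{α,n} = Λ_{α,τ(n)} ∘ ⋯ ∘ Λ_{α,τ(0)}`. -/
def phiTau (n : ℕ) : Torus → Torus := compUpTo (fun k => lamSeq D α c z₀ δ (tau k)) n

/-- `G⁻¹ ∘ R ∘ F` on `X`, where `G⁻¹` is the inverse of the bijection `G : X → X`. -/
def conjOn (X : Set Torus) (G R F : Torus → Torus) (w : Torus) : Torus :=
  Function.invFunOn G X (R (F w))

end DenjoyRees

end

open DenjoyRees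

noncomputable section

namespace DenjoyRees

section

/-! ### The function `p_α` -/

/-! Everything is read in one vertical coordinate. For `0 ≤ r ≤ 1/4` the map `h_r` sends `[-3/4,
3/4]` onto `[-1/2, 1/2]` with the same end values, so modulo `1` all `h_r` with `r > 0` are charts
of one circle, namely `[-3/4, 3/4]` with its ends glued. If the height over a centre `z` is written
as `h_δ(u)`, then `Λ` becomes the single formula `h_δ(u) ↦ h_r(u)` with `r = min ‖x - z.1‖ δ`, valid
on the whole torus (`lam_apply`). Only `r = 0` fails to be injective, and there only `[-1/2, 1/2]`
is collapsed, onto the centre (`lam_collapse`). Compactness turns injectivity for `r > 0` into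
uniform moduli (`hMap_equicontinuous`). The oscillation of `p_α` near `0` is harmless, because `p_α`
enters `h_t` only through `t` times a bounded function.

Consequently a composition of `Λ`s has, away from its columns, an inverse modulus that does not
depend on the sizes of the squares (`lamComp_inverse_equicontinuous`). Minimality makes the columns
distinct, so thresholds for `δ n` can be fixed in advance: one makes step `n` shrink the distance of
well separated points by a factor at least `1 - 1/(n+2)^2` (`exists_separation_threshold`), others
make consecutive conjugated maps differ by less than `(1/2)^n` (`exists_cauchy_threshold`). The
product telescopes and stays above `2/3`, so points with the same limit are already identified at a
finite stage; they then sit on a centre, which later steps leave alone.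

For the conjugated maps, translation carries `Λ` at `z` to `Λ` at the translated centre with the
same size (`lam_add`). Near a column the quotient of two such maps of different sizes reads `h_δ'(u)
↦ h_δ(u)`, with no dependence on the horizontal position, so the singularity cancels
(`lam_symm_comp_equicontinuous`, `conj_equicontinuous`). As `σ` and `τ` displace indices by at most
`2` and neighbouring factors commute, `Φ^σ_n` and `Φ^τ_n` also converge to `Φ`. The limits of the
conjugated maps therefore lift `T` and `T⁻¹` through `Φ`, and injectivity of `Φ` on the dense set
`X` makes them mutually inverse (`existsUnique_homeomorph`). -/

lemma continuous_seg (x₀ y₀ x₁ y₁ : ℝ) : Continuous (seg x₀ y₀ x₁ y₁) := by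
  unfold seg
  fun_prop

lemma seg_left (x₀ y₀ x₁ y₁ : ℝ) : seg x₀ y₀ x₁ y₁ x₀ = y₀ := by simp [seg]

lemma seg_right {x₀ x₁ : ℝ} (h : x₀ < x₁) (y₀ y₁ : ℝ) : seg x₀ y₀ x₁ y₁ x₁ = y₁ := by
  have : x₁ - x₀ ≠ 0 := by linarith
  unfold seg
  field_simp
  ring

lemma seg_mem_Icc {x₀ x₁ y₀ y₁ a b u : ℝ} (h₀ : y₀ ∈ Icc a b) (h₁ : y₁ ∈ Icc a b)
    (hu : u ∈ Icc x₀ x₁) (hx : x₀ < x₁) : seg x₀ y₀ x₁ y₁ u ∈ Icc a b := by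
  have hx' : 0 < x₁ - x₀ := by linarith
  set l := (u - x₀) / (x₁ - x₀) with hl
  have hl0 : 0 ≤ l := div_nonneg (by linarith [hu.1]) hx'.le
  have hl1 : 0 ≤ 1 - l := by
    rw [sub_nonneg, hl, div_le_one hx']
    linarith [hu.2]
  have he : seg x₀ y₀ x₁ y₁ u = (1 - l) * y₀ + l * y₁ := by
    unfold seg
    rw [hl]
    field_simp
    ring
  rw [he]
  exact (convex_Icc a b) h₀ h₁ hl1 hl0 (by ring)

variable (D : StripData) (α : ℕ → ℝ)

lemma StripData.eps_succ_lt (k : ℕ) : D.eps (k + 1) < D.eps k :=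
  D.eps_strictAnti (Nat.lt_succ_self k)

lemma continuous_stripVal (k : ℕ) : Continuous (stripVal D α k) := by
  have h12 := D.e1_lt_e2 k
  have h23 := D.e2_lt_e3 k
  unfold stripVal
  refine Continuous.if_le continuous_const ?_ continuous_id continuous_const ?_
  · refine Continuous.if_le (continuous_seg _ _ _ _) ?_ continuous_id continuous_const ?_
    · refine Continuous.if_le continuous_const (continuous_seg _ _ _ _)
        continuous_id continuous_const ?_
      rintro x rfl
      rw [seg_left]
    · rintro x rfl
      rw [if_pos h23.le, seg_right h12]
  · rintro x rfl
    rw [if_pos h12.le, seg_left]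

lemma stripVal_eps_succ (k : ℕ) : stripVal D α k (D.eps (k + 1)) = lowVal D α k :=
  if_pos (D.eps_lt_e1 k).le

lemma stripVal_eps (k : ℕ) : stripVal D α k (D.eps k) = topVal D α k := by
  have h12 := D.e1_lt_e2 k
  have h23 := D.e2_lt_e3 k
  have h34 := D.e3_lt_eps k
  unfold stripVal
  rw [if_neg (by linarith), if_neg (by linarith), if_neg (by linarith), seg_right h34]

/-- The function `p_α` on `(ε_{k+1}, ∞)`, extended to the left by its formula on the `k`-th
strip. -/
def pAux : ℕ → ℝ → ℝ
  | 0 => stripVal D α 0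
  | k + 1 => fun t => if t ≤ D.eps (k + 1) then stripVal D α (k + 1) t else pAux k t

lemma pAux_of_le {k : ℕ} {t : ℝ} (ht : t ≤ D.eps k) : pAux D α k t = stripVal D α k t := by
  cases k with
  | zero => rfl
  | succ k => exact if_pos ht

lemma continuous_pAux (k : ℕ) : Continuous (pAux D α k) := by
  induction k with
  | zero => exact continuous_stripVal D α 0
  | succ k ih =>
    refine Continuous.if_le (continuous_stripVal D α (k + 1)) ih continuous_id
      continuous_const ?_
    rintro x rfl
    rw [stripVal_eps, pAux_of_le D α (D.eps_succ_lt k).le, stripVal_eps_succ]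
    simp [topVal]

/-- No upper bound is needed for `k = 0`: beyond `1` the function continues by the formula of the
top strip, so continuity at `t = 1` is two-sided. -/
lemma pFun_eq_stripVal {k : ℕ} {t : ℝ} (h₁ : D.eps (k + 1) < t) (h₂ : k = 0 ∨ t ≤ D.eps k) :
    pFun D α t = stripVal D α k t := by
  classical
  have h : ∃ k, D.eps (k + 1) < t := ⟨k, h₁⟩
  have hk : Nat.find h = k := by
    rw [Nat.find_eq_iff]
    refine ⟨h₁, fun m hm hlt => ?_⟩
    rcases h₂ with rfl | h₂
    · omega
    · have := D.eps_strictAnti.antitone (show m + 1 ≤ k by omega)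
      linarith
  unfold pFun
  rw [dif_pos h]
  congr!

lemma pFun_eq_pAux {k : ℕ} {t : ℝ} (h : D.eps (k + 1) < t) : pFun D α t = pAux D α k t := by
  induction k with
  | zero => exact pFun_eq_stripVal D α h (Or.inl rfl)
  | succ k ih =>
    by_cases ht : t ≤ D.eps (k + 1)
    · rw [pAux_of_le D α ht]
      exact pFun_eq_stripVal D α h (Or.inr ht)
    · rw [ih (not_le.1 ht)]
      exact (if_neg ht).symm

lemma StripData.exists_eps_succ_lt {t : ℝ} (ht : 0 < t) : ∃ k, D.eps (k + 1) < t := by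
  obtain ⟨k, hk⟩ := (D.eps_tendsto.eventually (gt_mem_nhds ht)).exists
  exact ⟨k, (D.eps_succ_lt k).trans hk⟩

lemma continuousAt_pFun {t : ℝ} (ht : 0 < t) : ContinuousAt (pFun D α) t := by
  obtain ⟨k, hk⟩ := D.exists_eps_succ_lt ht
  refine (continuous_pAux D α k).continuousAt.congr ?_
  filter_upwards [lt_mem_nhds hk] with s hs
  exact (pFun_eq_pAux D α hs).symm

variable {α}

lemma stripVal_mem (hα : ∀ k, α k ∈ Icc (0 : ℝ) 1) {k : ℕ} {t : ℝ} (ht : t ≤ D.eps k) :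
    stripVal D α k t ∈ Icc (0 : ℝ) (1 / 4) := by
  have h12 := D.e1_lt_e2 k
  have h23 := D.e2_lt_e3 k
  have h34 := D.e3_lt_eps k
  have quarter : ∀ x ∈ Icc (0 : ℝ) 1, x / 4 ∈ Icc (0 : ℝ) (1 / 4) := fun x hx =>
    ⟨by linarith [hx.1], by linarith [hx.2]⟩
  have hlow : ∀ j, lowVal D α j ∈ Icc (0 : ℝ) (1 / 4) := by
    intro j
    unfold lowVal
    split_ifs
    exacts [quarter _ (D.q_mem 0), quarter _ (hα j)]
  have hhigh : highVal D α k ∈ Icc (0 : ℝ) (1 / 4) := by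
    unfold highVal
    split_ifs
    exacts [quarter _ (hα 0), quarter _ (D.q_mem k)]
  have htop : topVal D α k ∈ Icc (0 : ℝ) (1 / 4) := by
    unfold topVal
    split_ifs
    exacts [⟨by norm_num, le_rfl⟩, hlow _]
  unfold stripVal
  split_ifs with h1 h2 h3
  · exact hlow k
  · exact seg_mem_Icc (hlow k) hhigh ⟨by linarith, h2⟩ h12
  · exact hhigh
  · exact seg_mem_Icc hhigh htop ⟨by linarith, ht⟩ h34

lemma pFun_mem (hα : ∀ k, α k ∈ Icc (0 : ℝ) 1) {t : ℝ} (ht : t ≤ 1) :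
    pFun D α t ∈ Icc (0 : ℝ) (1 / 4) := by
  classical
  by_cases h : ∃ k, D.eps (k + 1) < t
  · unfold pFun
    rw [dif_pos h]
    apply stripVal_mem D hα
    rcases hk : Nat.find h with _ | k
    · rwa [D.eps_zero]
    · exact not_lt.1 (Nat.find_min h (m := k) (by omega))
  -- For `t ≤ 0` the default value `0` lies in the interval too; this lets later formulas include `t
  -- = 0`.
  · unfold pFun
    rw [dif_neg h]
    norm_num

/-! ### The maps `h^α_t` -/

/-- The restriction of a number to `[-1/2, 1/2]`. -/
def clampHalf (u : ℝ) : ℝ := max (-(1 / 2)) (min u (1 / 2))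

/-- The polyline through `(-1/2, -1/2)`, `(p, 1/4)`, `(1/2, 1/2)`, continued by constants. -/
def midLine (p u : ℝ) : ℝ :=
  -(1 / 2) + 3 / 4 / (p + 1 / 2) * (min (clampHalf u) p + 1 / 2) +
    1 / 4 / (1 / 2 - p) * max (clampHalf u - p) 0

/-- The part of `h^α_t` that does not depend on `p_α`. -/
def outLine (t u : ℝ) : ℝ :=
  max (u - 1 / 2) 0 + max (u - (1 + t) / 2) 0 - max (-(1 / 2) - u) 0 - max (-(1 + t) / 2 - u) 0

/-- This form isolates `p`: it occurs only in a bounded term multiplied by `t`, and the rest is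
jointly continuous. The case `t = 0` is included; at `t = 1` the outer segments degenerate. -/
lemma polyline_eq {p t : ℝ} (hp : p ∈ Icc (0 : ℝ) (1 / 4)) (ht0 : 0 ≤ t) (ht1 : t < 1) (u : ℝ) :
    polyline p t u = t * midLine p u + outLine t u := by
  obtain ⟨hp0, hp1⟩ := hp
  have k1 : 3 / 4 / (p + 1 / 2) * (p + 1 / 2) = 3 / 4 := div_mul_cancel₀ _ (by positivity)
  have k2 : 1 / 4 / (1 / 2 - p) * (1 / 2 - p) = 1 / 4 := div_mul_cancel₀ _ (by linarith)
  unfold polyline midLine outLine seg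
  have hc1 : u ≤ -(1 / 2) → clampHalf u = -(1 / 2) := fun h => by
    unfold clampHalf; rw [min_eq_left (by linarith), max_eq_left h]
  have hc2 : -(1 / 2) < u → u ≤ 1 / 2 → clampHalf u = u := fun h h' => by
    unfold clampHalf; rw [min_eq_left h', max_eq_right h.le]
  have hc3 : 1 / 2 < u → clampHalf u = 1 / 2 := fun h => by
    unfold clampHalf; rw [min_eq_right h.le, max_eq_right (by norm_num)]
  split_ifs with a b c d e
  · rw [hc1 (by linarith), min_eq_left (by linarith), max_eq_right (by linarith),
      max_eq_right (by linarith), max_eq_right (by linarith), max_eq_left (by linarith),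
      max_eq_left (by linarith),
      show (-t - -1) / (-(1 + t) / 2 - -1) = 2 by rw [div_eq_iff (by linarith)]; ring]
    ring
  · rw [hc1 (by linarith), min_eq_left (by linarith), max_eq_right (by linarith),
      max_eq_right (by linarith), max_eq_right (by linarith), max_eq_left (by linarith),
      max_eq_right (by linarith),
      show (-t / 2 - -t) / (-(1 / 2) - -(1 + t) / 2) = 1 by
        rw [div_eq_iff (by linarith)]; ring]
    ring
  · rw [hc2 (by linarith) (by linarith), min_eq_left (by linarith), max_eq_right (by linarith),
      max_eq_right (by linarith), max_eq_right (by linarith), max_eq_right (by linarith),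
      max_eq_right (by linarith), sub_neg_eq_add p, sub_neg_eq_add u]
    ring
  · rw [hc2 (by linarith) (by linarith), min_eq_right (by linarith), max_eq_left (by linarith),
      max_eq_right (by linarith), max_eq_right (by linarith), max_eq_right (by linarith),
      max_eq_right (by linarith)]
    linear_combination -t * k1
  · rw [hc3 (by linarith), min_eq_right (by linarith), max_eq_left (by linarith),
      max_eq_left (by linarith), max_eq_right (by linarith), max_eq_right (by linarith),
      max_eq_right (by linarith),
      show (t - t / 2) / ((1 + t) / 2 - 1 / 2) = 1 by rw [div_eq_iff (by linarith)]; ring]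
    linear_combination -t * k1 - t * k2
  · rw [hc3 (by linarith), min_eq_right (by linarith), max_eq_left (by linarith),
      max_eq_left (by linarith), max_eq_left (by linarith), max_eq_right (by linarith),
      max_eq_right (by linarith),
      show (1 - t) / (1 - (1 + t) / 2) = 2 by rw [div_eq_iff (by linarith)]; ring]
    linear_combination -t * k1 - t * k2

lemma hMap_eq (hα : ∀ k, α k ∈ Icc (0 : ℝ) 1) {t : ℝ} (ht0 : 0 ≤ t) (ht1 : t < 1) (u : ℝ) :
    hMap D α t u = t * midLine (pFun D α t) u + outLine t u := by
  unfold hMap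
  rw [abs_of_nonneg ht0]
  exact polyline_eq (pFun_mem D hα ht1.le) ht0 ht1 u

lemma midLine_mem {p : ℝ} (hp : p ∈ Icc (0 : ℝ) (1 / 4)) (u : ℝ) :
    midLine p u ∈ Icc (-(1 / 2) : ℝ) (1 / 2) := by
  obtain ⟨hp0, hp1⟩ := hp
  have h1 : 0 < p + 1 / 2 := by positivity
  have h2 : 0 < 1 / 2 - p := by linarith
  have hc1 : -(1 / 2) ≤ clampHalf u := le_max_left _ _
  have hc2 : clampHalf u ≤ 1 / 2 := max_le (by norm_num) (min_le_right _ _)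
  have a0 : 0 ≤ min (clampHalf u) p + 1 / 2 := by
    have := le_min hc1 (show -(1 / 2) ≤ p by linarith)
    linarith
  have a1 : min (clampHalf u) p + 1 / 2 ≤ p + 1 / 2 := by linarith [min_le_right (clampHalf u) p]
  have b0 : 0 ≤ max (clampHalf u - p) 0 := le_max_right _ _
  have b1 : max (clampHalf u - p) 0 ≤ 1 / 2 - p := max_le (by linarith) h2.le
  unfold midLine
  have c1 : 3 / 4 / (p + 1 / 2) * (p + 1 / 2) = 3 / 4 := div_mul_cancel₀ _ h1.ne'
  have c2 : 1 / 4 / (1 / 2 - p) * (1 / 2 - p) = 1 / 4 := div_mul_cancel₀ _ h2.ne'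
  have d1 := mul_le_mul_of_nonneg_left a1 (show 0 ≤ 3 / 4 / (p + 1 / 2) by positivity)
  have d2 := mul_le_mul_of_nonneg_left b1 (show 0 ≤ 1 / 4 / (1 / 2 - p) by positivity)
  have d3 : 0 ≤ 3 / 4 / (p + 1 / 2) * (min (clampHalf u) p + 1 / 2) := by positivity
  have d4 : 0 ≤ 1 / 4 / (1 / 2 - p) * max (clampHalf u - p) 0 := by positivity
  constructor <;> linarith

lemma continuousAt_hMap (hα : ∀ k, α k ∈ Icc (0 : ℝ) 1) {t : ℝ} (ht0 : 0 ≤ t) (ht1 : t < 1)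
    (u : ℝ) : ContinuousWithinAt (fun x : ℝ × ℝ => hMap D α x.1 x.2) {x | 0 ≤ x.1} (t, u) := by
  have hout : Continuous fun x : ℝ × ℝ => outLine x.1 x.2 := by
    unfold outLine
    fun_prop
  have hmem : ∀ᶠ x : ℝ × ℝ in 𝓝[{x | 0 ≤ x.1}] (t, u), 0 ≤ x.1 ∧ x.1 < 1 :=
    (eventually_mem_nhdsWithin).and (mem_nhdsWithin_of_mem_nhds
      ((isOpen_lt continuous_fst continuous_const).mem_nhds ht1))
  have key : ContinuousWithinAt (fun x : ℝ × ℝ => x.1 * midLine (pFun D α x.1) x.2)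
      {x | 0 ≤ x.1} (t, u) := by
    -- At `t = 0` the function `p_α` may have no limit, but the factor `t` squeezes the term to `0`.
    rcases ht0.eq_or_lt with rfl | hpos
    · unfold ContinuousWithinAt
      simp only [zero_mul]
      refine squeeze_zero_norm' (a := fun x : ℝ × ℝ => x.1) ?_ ?_
      · filter_upwards [hmem] with x hx
        have h := midLine_mem (pFun_mem D hα hx.2.le) x.2
        rw [norm_mul, Real.norm_of_nonneg hx.1]
        refine mul_le_of_le_one_right hx.1 ?_
        rw [Real.norm_eq_abs, abs_le]
        constructor <;> linarith [h.1, h.2]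
      · exact continuous_fst.continuousAt.continuousWithinAt (x := ((0 : ℝ), u))
    · apply ContinuousAt.continuousWithinAt
      have hp := pFun_mem D hα ht1.le
      have hpc : ContinuousAt (fun x : ℝ × ℝ => pFun D α x.1) (t, u) :=
        ContinuousAt.comp (g := pFun D α) (continuousAt_pFun D α hpos) continuousAt_fst
      have h1 : pFun D α t + 1 / 2 ≠ 0 := by have := hp.1; positivity
      have h2 : 1 / 2 - pFun D α t ≠ 0 := by linarith [hp.2]
      unfold midLine clampHalf
      fun_prop (disch := assumption)
  refine (key.add hout.continuousAt.continuousWithinAt).congr_of_eventuallyEq ?_ ?_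
  · filter_upwards [hmem] with x hx
    exact hMap_eq D hα hx.1 hx.2 x.2
  · exact hMap_eq D hα ht0 ht1 u

lemma monotone_clampHalf : Monotone clampHalf := fun _ _ h =>
  max_le_max le_rfl (min_le_min h le_rfl)

/-- The bounds `0 ≤ p ≤ 1/4` keep the two middle slopes at least `t` and `t/2`, while the outer
slopes are at least `1`. The identity `split` cuts `v - u` into its parts on these pieces. -/
lemma hMap_sub_ge (hα : ∀ k, α k ∈ Icc (0 : ℝ) 1) {t u v : ℝ} (ht0 : 0 ≤ t) (ht1 : t < 1)
    (huv : u ≤ v) : t / 2 * (v - u) ≤ hMap D α t v - hMap D α t u := by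
  rw [hMap_eq D hα ht0 ht1, hMap_eq D hα ht0 ht1]
  have hp := pFun_mem D hα ht1.le
  set p := pFun D α t
  obtain ⟨hp0, hp1⟩ := hp
  have c1 : 1 ≤ 3 / 4 / (p + 1 / 2) := by rw [le_div_iff₀ (by positivity)]; linarith
  have c2 : 1 / 2 ≤ 1 / 4 / (1 / 2 - p) := by rw [le_div_iff₀ (by linarith)]; linarith
  have hc := monotone_clampHalf huv
  have i1 : min (clampHalf u) p ≤ min (clampHalf v) p := min_le_min hc le_rfl
  have i2 : max (clampHalf u - p) 0 ≤ max (clampHalf v - p) 0 :=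
    max_le_max (by linarith) le_rfl
  have i3 : max (u - 1 / 2) 0 ≤ max (v - 1 / 2) 0 := max_le_max (by linarith) le_rfl
  have i4 : max (-(1 / 2) - v) 0 ≤ max (-(1 / 2) - u) 0 := max_le_max (by linarith) le_rfl
  have i5 : max (u - (1 + t) / 2) 0 ≤ max (v - (1 + t) / 2) 0 := max_le_max (by linarith) le_rfl
  have i6 : max (-(1 + t) / 2 - v) 0 ≤ max (-(1 + t) / 2 - u) 0 :=
    max_le_max (by linarith) le_rfl
  have split : ∀ x : ℝ, x = min (clampHalf x) p + max (clampHalf x - p) 0 + max (x - 1 / 2) 0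
      - max (-(1 / 2) - x) 0 := by
    intro x
    unfold clampHalf
    grind
  have hu := split u
  have hv := split v
  unfold midLine outLine
  have d1 := mul_le_mul_of_nonneg_left (mul_le_mul_of_nonneg_right c1 (sub_nonneg.2 i1)) ht0
  have d2 := mul_le_mul_of_nonneg_left (mul_le_mul_of_nonneg_right c2 (sub_nonneg.2 i2)) ht0
  have d3 := mul_le_mul_of_nonneg_right (show t / 2 ≤ 1 by linarith) (sub_nonneg.2 i3)
  have d4 := mul_le_mul_of_nonneg_right (show t / 2 ≤ 1 by linarith) (sub_nonneg.2 i4)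
  have d5 := mul_nonneg ht0 (sub_nonneg.2 i1)
  have e : t / 2 * (v - u) = t / 2 * ((min (clampHalf v) p - min (clampHalf u) p) +
      (max (clampHalf v - p) 0 - max (clampHalf u - p) 0) +
      (max (v - 1 / 2) 0 - max (u - 1 / 2) 0) +
      (max (-(1 / 2) - u) 0 - max (-(1 / 2) - v) 0)) := by
    congr 1
    linarith
  rw [e]
  linarith

lemma strictMono_hMap (hα : ∀ k, α k ∈ Icc (0 : ℝ) 1) {t : ℝ} (ht0 : 0 < t) (ht1 : t < 1) :
    StrictMono (hMap D α t) := fun u v huv => by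
  have h := hMap_sub_ge D hα ht0.le ht1 huv.le
  have : 0 < t / 2 * (v - u) := mul_pos (by linarith) (by linarith)
  linarith

lemma monotone_hMap (hα : ∀ k, α k ∈ Icc (0 : ℝ) 1) {t : ℝ} (ht0 : 0 ≤ t) (ht1 : t < 1) :
    Monotone (hMap D α t) := fun u v huv => by
  have h := hMap_sub_ge D hα ht0 ht1 huv
  have : 0 ≤ t / 2 * (v - u) := mul_nonneg (by linarith) (by linarith)
  linarith

lemma hMap_of_ge (hα : ∀ k, α k ∈ Icc (0 : ℝ) 1) {t u : ℝ} (ht0 : 0 ≤ t) (ht1 : t < 1)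
    (hu : (1 + t) / 2 ≤ u) : hMap D α t u = 2 * u - 1 := by
  have hp := pFun_mem D hα ht1.le
  rw [hMap_eq D hα ht0 ht1]
  set p := pFun D α t
  obtain ⟨hp0, hp1⟩ := hp
  have k1 : 3 / 4 / (p + 1 / 2) * (p + 1 / 2) = 3 / 4 := div_mul_cancel₀ _ (by positivity)
  have k2 : 1 / 4 / (1 / 2 - p) * (1 / 2 - p) = 1 / 4 := div_mul_cancel₀ _ (by linarith)
  unfold midLine outLine clampHalf
  rw [min_eq_right (show 1 / 2 ≤ u by linarith), max_eq_right (by norm_num),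
    min_eq_right (by linarith), max_eq_left (by linarith), max_eq_left (by linarith),
    max_eq_left (by linarith), max_eq_right (by linarith), max_eq_right (by linarith)]
  linear_combination t * k1 + t * k2

lemma hMap_of_le (hα : ∀ k, α k ∈ Icc (0 : ℝ) 1) {t u : ℝ} (ht0 : 0 ≤ t) (ht1 : t < 1)
    (hu : u ≤ -((1 + t) / 2)) : hMap D α t u = 2 * u + 1 := by
  have hp := pFun_mem D hα ht1.le
  rw [hMap_eq D hα ht0 ht1]
  set p := pFun D α t
  obtain ⟨hp0, hp1⟩ := hp
  have h1 : p + 1 / 2 ≠ 0 := by positivity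
  unfold midLine outLine clampHalf
  rw [min_eq_left (show u ≤ 1 / 2 by linarith), max_eq_left (by linarith),
    min_eq_left (by linarith), max_eq_right (by linarith), max_eq_right (by linarith),
    max_eq_right (by linarith), max_eq_left (by linarith), max_eq_left (by linarith)]
  field_simp
  ring

lemma hMap_zero_of_abs_le (hα : ∀ k, α k ∈ Icc (0 : ℝ) 1) {u : ℝ} (hu : |u| ≤ 1 / 2) :
    hMap D α 0 u = 0 := by
  obtain ⟨h1, h2⟩ := abs_le.1 hu
  rw [hMap_eq D hα le_rfl one_pos]
  unfold outLine
  rw [max_eq_right (by linarith), max_eq_right (by linarith), max_eq_right (by linarith),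
    max_eq_right (by linarith)]
  ring

end

section
variable {D : StripData} {α : ℕ → ℝ}

/-! ### Distances on the circle -/

lemma coe_rep (θ : UnitAddCircle) : ((rep θ : ℝ) : UnitAddCircle) = θ :=
  AddCircle.coe_equivIco

lemma rep_mem (θ : UnitAddCircle) : rep θ ∈ Ico (-1 / 2 : ℝ) (1 / 2) := by
  have h := (AddCircle.equivIco (1 : ℝ) (-1 / 2) θ).2
  unfold rep
  constructor
  · exact h.1
  · linarith [h.2]

lemma norm_coe_of_abs_le {x : ℝ} (hx : |x| ≤ 1 / 2) : ‖(x : UnitAddCircle)‖ = |x| :=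
  (AddCircle.norm_coe_eq_abs_iff 1 one_ne_zero).2 (by simpa using hx)

lemma norm_coe_le_abs (x : ℝ) : ‖(x : UnitAddCircle)‖ ≤ |x| := by
  rw [UnitAddCircle.norm_eq]
  simpa using round_le x 0

lemma abs_rep (θ : UnitAddCircle) : |rep θ| = ‖θ‖ := by
  obtain ⟨h1, h2⟩ := rep_mem θ
  conv_rhs => rw [← coe_rep θ]
  exact (norm_coe_of_abs_le (abs_le.2 ⟨by linarith, h2.le⟩)).symm

lemma norm_le_half (θ : UnitAddCircle) : ‖θ‖ ≤ 1 / 2 := by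
  obtain ⟨h1, h2⟩ := rep_mem θ
  rw [← abs_rep]
  exact abs_le.2 ⟨by linarith, h2.le⟩

lemma coe_eq_coe_of_mem {x y : ℝ} (hx : x ∈ Icc (-(1 / 2) : ℝ) (1 / 2))
    (hy : y ∈ Icc (-(1 / 2) : ℝ) (1 / 2)) (h : (x : UnitAddCircle) = y) :
    x = y ∨ (x = 1 / 2 ∧ y = -(1 / 2)) ∨ (x = -(1 / 2) ∧ y = 1 / 2) := by
  have h' : ((x - y : ℝ) : UnitAddCircle) = 0 := by
    rw [AddCircle.coe_sub, h, sub_self]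
  obtain ⟨n, hn⟩ := (AddCircle.coe_eq_zero_iff 1).1 h'
  rw [zsmul_eq_mul, mul_one] at hn
  obtain ⟨hx1, hx2⟩ := hx
  obtain ⟨hy1, hy2⟩ := hy
  have n1 : n < 2 := by exact_mod_cast (show (n : ℝ) < 2 by linarith)
  have n2 : -2 < n := by exact_mod_cast (show (-2 : ℝ) < n by linarith)
  have : n = -1 ∨ n = 0 ∨ n = 1 := by omega
  rcases this with rfl | rfl | rfl
  · right; right
    push_cast at hn
    constructor <;> linarith
  · left
    push_cast at hn
    linarith
  · right; left
    push_cast at hn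
    constructor <;> linarith

/-! ### The family `h^α_t` modulo `1` -/

lemma hMap_three_quarters (hα : ∀ k, α k ∈ Icc (0 : ℝ) 1) {r : ℝ} (hr : r ∈ Icc (0 : ℝ) (1 / 4)) :
    hMap D α r (3 / 4) = 1 / 2 := by
  rw [hMap_of_ge D hα hr.1 (by linarith [hr.2]) (by linarith [hr.2])]
  norm_num

lemma hMap_neg_three_quarters (hα : ∀ k, α k ∈ Icc (0 : ℝ) 1) {r : ℝ}
    (hr : r ∈ Icc (0 : ℝ) (1 / 4)) : hMap D α r (-(3 / 4)) = -(1 / 2) := by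
  rw [hMap_of_le D hα hr.1 (by linarith [hr.2]) (by linarith [hr.2])]
  norm_num

lemma hMap_mem (hα : ∀ k, α k ∈ Icc (0 : ℝ) 1) {r u : ℝ} (hr : r ∈ Icc (0 : ℝ) (1 / 4))
    (hu : u ∈ Icc (-(3 / 4) : ℝ) (3 / 4)) : hMap D α r u ∈ Icc (-(1 / 2) : ℝ) (1 / 2) := by
  have hm := monotone_hMap D hα hr.1 (by linarith [hr.2])
  rw [← hMap_neg_three_quarters (D := D) hα hr, ← hMap_three_quarters (D := D) hα hr]
  exact ⟨hm hu.1, hm hu.2⟩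

lemma mem_of_hMap_mem (hα : ∀ k, α k ∈ Icc (0 : ℝ) 1) {r u : ℝ} (hr0 : 0 < r) (hr1 : r ≤ 1 / 4)
    (hu : hMap D α r u ∈ Icc (-(1 / 2) : ℝ) (1 / 2)) : u ∈ Icc (-(3 / 4) : ℝ) (3 / 4) := by
  have hm := strictMono_hMap D hα hr0 (by linarith)
  rw [← hMap_neg_three_quarters (D := D) hα ⟨hr0.le, hr1⟩,
    ← hMap_three_quarters (D := D) hα ⟨hr0.le, hr1⟩] at hu
  exact ⟨hm.le_iff_le.1 hu.1, hm.le_iff_le.1 hu.2⟩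

/-- For `r > 0` the only coincidence modulo `1` is that of the ends `±3/4`, and these are glued by
every `h_{r'}`. So a point of the circle seen through one nondegenerate chart has a well-defined
image under any other, including `r' = 0`. -/
lemma coe_hMap_congr (hα : ∀ k, α k ∈ Icc (0 : ℝ) 1) {r r' u v : ℝ} (hr0 : 0 < r)
    (hr1 : r ≤ 1 / 4) (hr' : r' ∈ Icc (0 : ℝ) (1 / 4)) (hu : u ∈ Icc (-(3 / 4) : ℝ) (3 / 4))
    (hv : v ∈ Icc (-(3 / 4) : ℝ) (3 / 4))
    (h : (hMap D α r u : UnitAddCircle) = hMap D α r v) :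
    (hMap D α r' u : UnitAddCircle) = hMap D α r' v := by
  have hr : r ∈ Icc (0 : ℝ) (1 / 4) := ⟨hr0.le, hr1⟩
  have hinj := (strictMono_hMap D hα hr0 (by linarith)).injective
  have wrap : ((1 / 2 : ℝ) : UnitAddCircle) = ((-(1 / 2) : ℝ) : UnitAddCircle) := by
    rw [← sub_eq_zero, ← AddCircle.coe_sub]
    norm_num
  rcases coe_eq_coe_of_mem (hMap_mem hα hr hu) (hMap_mem hα hr hv) h with h | ⟨h, h'⟩ | ⟨h, h'⟩
  · rw [hinj h]
  · rw [← hMap_three_quarters (D := D) hα hr] at h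
    rw [← hMap_neg_three_quarters (D := D) hα hr] at h'
    rw [hinj h, hinj h', hMap_three_quarters hα hr', hMap_neg_three_quarters hα hr', wrap]
  · rw [← hMap_neg_three_quarters (D := D) hα hr] at h
    rw [← hMap_three_quarters (D := D) hα hr] at h'
    rw [hinj h, hinj h', hMap_three_quarters hα hr', hMap_neg_three_quarters hα hr', wrap]

lemma exists_hMap_eq (hα : ∀ k, α k ∈ Icc (0 : ℝ) 1) {r s : ℝ} (hr : r ∈ Icc (0 : ℝ) (1 / 4))
    (hs : s ∈ Icc (-(1 / 2) : ℝ) (1 / 2)) :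
    ∃ u ∈ Icc (-(3 / 4) : ℝ) (3 / 4), hMap D α r u = s := by
  have hc : ContinuousOn (hMap D α r) (Icc (-(3 / 4)) (3 / 4)) := by
    intro u _
    have h := continuousAt_hMap D hα hr.1 (by linarith [hr.2]) u
    have h2 : ContinuousWithinAt (fun v : ℝ => (r, v)) (Icc (-(3 / 4)) (3 / 4)) u := by fun_prop
    exact ContinuousWithinAt.comp (g := fun x : ℝ × ℝ => hMap D α x.1 x.2) h h2 (fun _ _ => hr.1)
  have h := intermediate_value_Icc (by norm_num) hc
  rw [hMap_three_quarters hα hr, hMap_neg_three_quarters hα hr] at h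
  exact h hs

/-- On the compact set where `g ≥ η`, `f` attains its minimum, which is positive. This is the device
that turns exact implications into uniform moduli. -/
lemma exists_pos_forall_lt {Y : Type*} [TopologicalSpace Y] {K : Set Y}
    (hK : IsCompact K) {f g : Y → ℝ} (hf : ContinuousOn f K) (hg : ContinuousOn g K)
    (h0 : ∀ x ∈ K, f x ≤ 0 → g x ≤ 0) {η : ℝ} (hη : 0 < η) :
    ∃ κ > 0, ∀ x ∈ K, f x < κ → g x < η := by
  have hK' : IsCompact {x | x ∈ K ∧ η ≤ g x} := by
    obtain ⟨s, hs, he⟩ := continuousOn_iff_isClosed.1 hg (Ici η) isClosed_Ici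
    have : {x | x ∈ K ∧ η ≤ g x} = K ∩ s := by
      rw [inter_comm, ← he]
      ext x
      exact and_comm
    rw [this]
    exact hK.inter_right hs
  rcases {x | x ∈ K ∧ η ≤ g x}.eq_empty_or_nonempty with he | hne
  · refine ⟨1, one_pos, fun x hx _ => ?_⟩
    by_contra hlt
    have : x ∈ {x | x ∈ K ∧ η ≤ g x} := ⟨hx, not_lt.1 hlt⟩
    simp [he] at this
  · obtain ⟨x₀, hx₀, hmin⟩ := hK'.exists_isMinOn hne (hf.mono fun x hx => hx.1)
    refine ⟨f x₀, ?_, fun x hx hlt => ?_⟩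
    · by_contra hle
      have := h0 x₀ hx₀.1 (not_lt.1 hle)
      linarith [hx₀.2]
    · by_contra hge
      have := hmin ⟨hx, not_lt.1 hge⟩
      exact absurd hlt (not_lt.2 this)

/-- The quantitative form of `coe_hMap_congr`: changing charts is uniformly continuous as long as
the source parameters stay above `d`; the target parameters may reach `0`. -/
lemma hMap_equicontinuous (hα : ∀ k, α k ∈ Icc (0 : ℝ) 1) {d η : ℝ} (hd : 0 < d) (hη : 0 < η) :
    ∃ κ > 0, ∀ r₁ ∈ Icc d (1 / 4), ∀ r₁' ∈ Icc d (1 / 4), ∀ r₂ ∈ Icc (0 : ℝ) (1 / 4),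
      ∀ r₂' ∈ Icc (0 : ℝ) (1 / 4), ∀ u ∈ Icc (-(3 / 4) : ℝ) (3 / 4),
      ∀ u' ∈ Icc (-(3 / 4) : ℝ) (3 / 4), |r₁ - r₁'| < κ → |r₂ - r₂'| < κ →
      dist (hMap D α r₁ u : UnitAddCircle) (hMap D α r₁' u') < κ →
      dist (hMap D α r₂ u : UnitAddCircle) (hMap D α r₂' u') < η := by
  let I := Icc d (1 / 4)
  let J := Icc (0 : ℝ) (1 / 4)
  let U := Icc (-(3 / 4) : ℝ) (3 / 4)
  let K : Set (ℝ × ℝ × ℝ × ℝ × ℝ × ℝ) := I ×ˢ I ×ˢ J ×ˢ J ×ˢ U ×ˢ U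
  have hK : IsCompact K := isCompact_Icc.prod (isCompact_Icc.prod (isCompact_Icc.prod
    (isCompact_Icc.prod (isCompact_Icc.prod isCompact_Icc))))
  have hcont : ∀ r v : (ℝ × ℝ × ℝ × ℝ × ℝ × ℝ) → ℝ, Continuous r → Continuous v →
      (∀ x ∈ K, 0 ≤ r x ∧ r x ≤ 1 / 4) →
      ContinuousOn (fun x => ((hMap D α (r x) (v x) : ℝ) : UnitAddCircle)) K := by
    intro r v hr hv hmem x hx
    have h := continuousAt_hMap D hα (hmem x hx).1 (by linarith [(hmem x hx).2]) (v x)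
    have h2 : ContinuousWithinAt (fun x => (r x, v x)) K x :=
      (hr.prodMk hv).continuousWithinAt
    have h3 := ContinuousWithinAt.comp (g := fun x : ℝ × ℝ => hMap D α x.1 x.2)
      (f := fun x => (r x, v x)) (x := x) h h2 (fun y hy => (hmem y hy).1)
    exact (AddCircle.continuous_mk' (1 : ℝ)).continuousAt.comp_continuousWithinAt h3
  have c1 := hcont (fun x => x.1) (fun x => x.2.2.2.2.1) (by fun_prop) (by fun_prop)
    (fun x hx => ⟨hd.le.trans hx.1.1, hx.1.2⟩)
  have c2 := hcont (fun x => x.2.1) (fun x => x.2.2.2.2.2) (by fun_prop) (by fun_prop)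
    (fun x hx => ⟨hd.le.trans hx.2.1.1, hx.2.1.2⟩)
  have c3 := hcont (fun x => x.2.2.1) (fun x => x.2.2.2.2.1) (by fun_prop) (by fun_prop)
    (fun x hx => hx.2.2.1)
  have c4 := hcont (fun x => x.2.2.2.1) (fun x => x.2.2.2.2.2) (by fun_prop) (by fun_prop)
    (fun x hx => hx.2.2.2.1)
  obtain ⟨κ, hκ, h⟩ := exists_pos_forall_lt hK
    (f := fun x => |x.1 - x.2.1| + |x.2.2.1 - x.2.2.2.1| +
      dist ((hMap D α x.1 x.2.2.2.2.1 : ℝ) : UnitAddCircle) (hMap D α x.2.1 x.2.2.2.2.2 : ℝ))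
    (g := fun x => dist ((hMap D α x.2.2.1 x.2.2.2.2.1 : ℝ) : UnitAddCircle)
      (hMap D α x.2.2.2.1 x.2.2.2.2.2 : ℝ))
    (ContinuousOn.add (Continuous.continuousOn (by fun_prop)) (continuous_dist.comp_continuousOn (ContinuousOn.prodMk c1 c2))) (continuous_dist.comp_continuousOn (ContinuousOn.prodMk c3 c4))
    (by
      rintro ⟨r₁, r₁', r₂, r₂', u, u'⟩ ⟨hr₁, hr₁', hr₂, hr₂', hu, hu'⟩ h
      dsimp only at *
      have p1 := abs_nonneg (r₁ - r₁')
      have p2 := abs_nonneg (r₂ - r₂')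
      have p3 := dist_nonneg (x := (hMap D α r₁ u : UnitAddCircle)) (y := hMap D α r₁' u')
      have e1 : r₁ = r₁' := sub_eq_zero.1 (abs_eq_zero.1 (by linarith))
      have e2 : r₂ = r₂' := sub_eq_zero.1 (abs_eq_zero.1 (by linarith))
      have e3 := dist_eq_zero.1 (le_antisymm (by linarith) p3)
      subst e1 e2
      exact (dist_eq_zero.2 (coe_hMap_congr hα (hd.trans_le hr₁.1) hr₁.2 hr₂ hu hu' e3)).le) hη
  refine ⟨κ / 3, by positivity, fun r₁ hr₁ r₁' hr₁' r₂ hr₂ r₂' hr₂' u hu u' hu' a b e => ?_⟩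
  exact h (r₁, r₁', r₂, r₂', u, u') ⟨hr₁, hr₁', hr₂, hr₂', hu, hu'⟩ (by dsimp only; linarith)

/-! ### The maps `Λ` -/

lemma mem_square {z w : Torus} {δ : ℝ} :
    w ∈ square z δ ↔ ‖w.1 - z.1‖ ≤ δ ∧ ‖w.2 - z.2‖ ≤ δ := by
  constructor
  · rintro ⟨t, s, ht, hs, rfl⟩
    simp only [add_sub_cancel_left]
    exact ⟨(norm_coe_le_abs t).trans ht, (norm_coe_le_abs s).trans hs⟩
  · rintro ⟨h1, h2⟩
    refine ⟨rep (w.1 - z.1), rep (w.2 - z.2), ?_, ?_, ?_⟩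
    · rwa [abs_rep]
    · rwa [abs_rep]
    · rw [coe_rep, coe_rep, add_sub_cancel, add_sub_cancel]

/-- One formula covers both the square and its complement. Outside the square either the minimum is
`δ`, or `|u| ≥ (1 + δ)/2`, where all `h_r` with `r ≤ δ` coincide with `2u ∓ 1`. -/
lemma lam_apply (hα : ∀ k, α k ∈ Icc (0 : ℝ) 1) {δ : ℝ} (hδ0 : 0 < δ) (hδ1 : δ ≤ 1 / 4) (z : Torus)
    (x : UnitAddCircle) {u : ℝ} (hu : u ∈ Icc (-(3 / 4) : ℝ) (3 / 4)) :
    lam D α z δ (x, z.2 + (hMap D α δ u : ℝ)) =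
      (x, z.2 + (hMap D α (min ‖x - z.1‖ δ) u : ℝ)) := by
  have hmin : min ‖x - z.1‖ δ ∈ Icc (0 : ℝ) (1 / 4) :=
    ⟨le_min (norm_nonneg _) hδ0.le, (min_le_right _ _).trans hδ1⟩
  unfold lam
  simp only [mem_square, add_sub_cancel_left]
  split_ifs with h
  · obtain ⟨hx, hy⟩ := h
    set s := rep (hMap D α δ u : ℝ) with hs
    have hsδ : |s| ≤ δ := by rwa [hs, abs_rep]
    obtain ⟨hs1, hs2⟩ := abs_le.1 hsδ
    have hsm : s ∈ Icc (-(1 / 2) : ℝ) (1 / 2) := ⟨by linarith, by linarith⟩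
    obtain ⟨v, hv, hvs⟩ := exists_hMap_eq (D := D) hα ⟨hδ0.le, hδ1⟩ hsm
    have hinv : hMap D α δ (hInv D α δ s) = s :=
      Function.invFunOn_eq ⟨v, ⟨by linarith [hv.1], by linarith [hv.2]⟩, hvs⟩
    have habs : hMap D α (rep (x - z.1)) = hMap D α (min ‖x - z.1‖ δ) := by
      rw [min_eq_left hx, ← abs_rep]
      unfold hMap
      rw [abs_abs]
    rw [habs]
    congr 2
    -- The preimage chosen by `hInv` is compared with `u` only through `h_δ` modulo `1`, which
    -- suffices.
    refine coe_hMap_congr hα hδ0 hδ1 hmin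
      (mem_of_hMap_mem (D := D) hα hδ0 hδ1 (by rwa [hinv])) hu ?_
    rw [hinv, hs, coe_rep]
  · rcases lt_or_ge δ ‖x - z.1‖ with hx | hx
    · rw [min_eq_right hx.le]
    · have hy : δ < |hMap D α δ u| := by
        refine lt_of_lt_of_le ?_ (norm_coe_le_abs _)
        by_contra hle
        exact h ⟨hx, not_lt.1 hle⟩
      have hm := strictMono_hMap D hα hδ0 (by linarith)
      have hmδ : min ‖x - z.1‖ δ ≤ δ := min_le_right _ _
      have hm1 : min ‖x - z.1‖ δ < 1 := by linarith
      rcases lt_abs.1 hy with hy | hy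
      · have e : hMap D α δ ((1 + δ) / 2) = δ := by
          rw [hMap_of_ge D hα hδ0.le (by linarith) le_rfl]
          ring
        have hu' : (1 + δ) / 2 ≤ u := by
          rw [← hm.le_iff_le, e]
          exact hy.le
        rw [hMap_of_ge D hα hδ0.le (by linarith) hu',
          hMap_of_ge D hα hmin.1 hm1 (by linarith)]
      · have e : hMap D α δ (-((1 + δ) / 2)) = -δ := by
          rw [hMap_of_le D hα hδ0.le (by linarith) le_rfl]
          ring
        have hu' : u ≤ -((1 + δ) / 2) := by
          rw [← hm.le_iff_le, e]
          linarith
        rw [hMap_of_le D hα hδ0.le (by linarith) hu',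
          hMap_of_le D hα hmin.1 hm1 (by linarith)]

lemma exists_coord (hα : ∀ k, α k ∈ Icc (0 : ℝ) 1) {r : ℝ} (hr : r ∈ Icc (0 : ℝ) (1 / 4))
    (y y₀ : UnitAddCircle) :
    ∃ u ∈ Icc (-(3 / 4) : ℝ) (3 / 4), y = y₀ + (hMap D α r u : ℝ) := by
  obtain ⟨h1, h2⟩ := rep_mem (y - y₀)
  obtain ⟨u, hu, h⟩ := exists_hMap_eq (D := D) hα hr
    (show rep (y - y₀) ∈ Icc (-(1 / 2) : ℝ) (1 / 2) from ⟨by linarith, h2.le⟩)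
  exact ⟨u, hu, by rw [h, coe_rep, add_sub_cancel]⟩

lemma min_norm_mem {δ : ℝ} (hδ0 : 0 < δ) (hδ1 : δ ≤ 1 / 4) (θ : UnitAddCircle) :
    min ‖θ‖ δ ∈ Icc (0 : ℝ) (1 / 4) :=
  ⟨le_min (norm_nonneg _) hδ0.le, (min_le_right _ _).trans hδ1⟩

@[simp] lemma lam_fst (z : Torus) (δ : ℝ) (w : Torus) : (lam D α z δ w).1 = w.1 := by
  unfold lam
  split_ifs <;> rfl

lemma lam_of_le_norm (hα : ∀ k, α k ∈ Icc (0 : ℝ) 1) {δ : ℝ} (hδ0 : 0 < δ) (hδ1 : δ ≤ 1 / 4)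
    {z w : Torus} (h : δ ≤ ‖w.1 - z.1‖) : lam D α z δ w = w := by
  obtain ⟨x, y⟩ := w
  obtain ⟨u, hu, rfl⟩ := exists_coord (D := D) hα ⟨hδ0.le, hδ1⟩ y z.2
  rw [lam_apply hα hδ0 hδ1 z x hu, min_eq_right h]

/-- For `r ≤ δ`, both `h_r` and `h_δ` send `|u| ≤ (1 + δ)/2` into `[-δ, δ]`, and beyond that range
they agree. -/
lemma dist_lam_le (hα : ∀ k, α k ∈ Icc (0 : ℝ) 1) {δ : ℝ} (hδ0 : 0 < δ) (hδ1 : δ ≤ 1 / 4)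
    (z w : Torus) : dist (lam D α z δ w).2 w.2 ≤ 2 * δ := by
  obtain ⟨x, y⟩ := w
  obtain ⟨u, hu, rfl⟩ := exists_coord (D := D) hα ⟨hδ0.le, hδ1⟩ y z.2
  rw [lam_apply hα hδ0 hδ1 z x hu]
  have hmin := min_norm_mem hδ0 hδ1 (x - z.1)
  have hmδ : min ‖x - z.1‖ δ ≤ δ := min_le_right _ _
  have hm1 : min ‖x - z.1‖ δ < 1 := by linarith
  rw [dist_add_left, dist_eq_norm, ← AddCircle.coe_sub]
  refine (norm_coe_le_abs _).trans ?_
  by_cases h1 : (1 + δ) / 2 ≤ u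
  · rw [hMap_of_ge D hα hδ0.le (by linarith) h1, hMap_of_ge D hα hmin.1 hm1 (by linarith),
      sub_self, abs_zero]
    linarith
  by_cases h2 : u ≤ -((1 + δ) / 2)
  · rw [hMap_of_le D hα hδ0.le (by linarith) h2, hMap_of_le D hα hmin.1 hm1 (by linarith),
      sub_self, abs_zero]
    linarith
  have key : ∀ r ∈ Icc 0 δ, |hMap D α r u| ≤ δ := by
    intro r hr
    have hm := monotone_hMap D hα hr.1 (by linarith [hr.2])
    have a := hm (not_le.1 h1).le
    have b := hm (not_le.1 h2).le
    rw [hMap_of_ge D hα (u := (1 + δ) / 2) hr.1 (by linarith [hr.2]) (by linarith [hr.2])] at a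
    rw [hMap_of_le D hα (u := -((1 + δ) / 2)) hr.1 (by linarith [hr.2]) (by linarith [hr.2])] at b
    exact abs_le.2 ⟨by linarith, by linarith⟩
  have a := key _ ⟨hmin.1, hmδ⟩
  have b := key δ ⟨hδ0.le, le_rfl⟩
  exact (abs_sub _ _).trans (by linarith)

lemma abs_min_norm_sub_le (a b x : UnitAddCircle) (δ : ℝ) :
    |min ‖a - x‖ δ - min ‖b - x‖ δ| ≤ dist a b := by
  refine (abs_inf_sub_inf_le_abs _ _ _).trans ?_
  rw [dist_eq_norm]
  simpa using abs_norm_sub_norm_le (a - x) (b - x)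

lemma lam_continuous (hα : ∀ k, α k ∈ Icc (0 : ℝ) 1) {δ : ℝ} (hδ0 : 0 < δ) (hδ1 : δ ≤ 1 / 4)
    (z : Torus) : Continuous (lam D α z δ) := by
  refine Metric.continuous_iff.2 fun W η hη => ?_
  obtain ⟨κ, hκ, h⟩ := hMap_equicontinuous (D := D) hα hδ0 hη
  refine ⟨min κ η, lt_min hκ hη, fun V hVW => ?_⟩
  obtain ⟨x, y⟩ := V
  obtain ⟨x', y'⟩ := W
  obtain ⟨u, hu, rfl⟩ := exists_coord (D := D) hα ⟨hδ0.le, hδ1⟩ y z.2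
  obtain ⟨u', hu', rfl⟩ := exists_coord (D := D) hα ⟨hδ0.le, hδ1⟩ y' z.2
  rw [Prod.dist_eq, max_lt_iff, dist_add_left, lt_min_iff, lt_min_iff] at hVW
  obtain ⟨⟨hx1, hx2⟩, hy1, -⟩ := hVW
  rw [lam_apply hα hδ0 hδ1 z x hu, lam_apply hα hδ0 hδ1 z x' hu', Prod.dist_eq, max_lt_iff,
    dist_add_left]
  exact ⟨hx2, h δ ⟨le_rfl, hδ1⟩ δ ⟨le_rfl, hδ1⟩ _ (min_norm_mem hδ0 hδ1 _) _
    (min_norm_mem hδ0 hδ1 _) u hu u' hu' (by simpa using hκ)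
    ((abs_min_norm_sub_le x x' z.1 δ).trans_lt hx1) hy1⟩

/-- Away from the centre `lam` is injective, with a modulus that does not depend on `δ`. -/
lemma lam_inverse_equicontinuous (hα : ∀ k, α k ∈ Icc (0 : ℝ) 1) {d η : ℝ} (hd : 0 < d)
    (hη : 0 < η) :
    ∃ κ > 0, ∀ (z : Torus) (δ : ℝ), 0 < δ → δ ≤ 1 / 4 → ∀ V W : Torus,
      d ≤ ‖V.1 - z.1‖ → d ≤ ‖W.1 - z.1‖ →
      dist (lam D α z δ V) (lam D α z δ W) < κ → dist V W < η := by
  obtain ⟨κ, hκ, h⟩ := hMap_equicontinuous (D := D) hα hd hη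
  refine ⟨min κ η, lt_min hκ hη, fun z δ hδ0 hδ1 V W hV hW hVW => ?_⟩
  -- A square with `δ ≤ d` does not move the two points; otherwise the parameters of the charts lie
  -- in `[d, 1/4]`. This is why the modulus is independent of `δ`.
  rcases le_or_gt δ d with hδd | hδd
  · rw [lam_of_le_norm hα hδ0 hδ1 (hδd.trans hV), lam_of_le_norm hα hδ0 hδ1 (hδd.trans hW)] at hVW
    exact hVW.trans_le (min_le_right _ _)
  obtain ⟨x, y⟩ := V
  obtain ⟨x', y'⟩ := W
  obtain ⟨u, hu, rfl⟩ := exists_coord (D := D) hα ⟨hδ0.le, hδ1⟩ y z.2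
  obtain ⟨u', hu', rfl⟩ := exists_coord (D := D) hα ⟨hδ0.le, hδ1⟩ y' z.2
  rw [lam_apply hα hδ0 hδ1 z x hu, lam_apply hα hδ0 hδ1 z x' hu', Prod.dist_eq, max_lt_iff,
    dist_add_left, lt_min_iff, lt_min_iff] at hVW
  obtain ⟨⟨hx1, hx2⟩, hy1, -⟩ := hVW
  rw [Prod.dist_eq, max_lt_iff, dist_add_left]
  exact ⟨hx2, h _ ⟨le_min hV hδd.le, (min_norm_mem hδ0 hδ1 _).2⟩ _
    ⟨le_min hW hδd.le, (min_norm_mem hδ0 hδ1 _).2⟩ δ ⟨hδ0.le, hδ1⟩ δ ⟨hδ0.le, hδ1⟩ u hu u' hu'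
    ((abs_min_norm_sub_le x x' z.1 δ).trans_lt hx1) (by simpa using hκ) hy1⟩

lemma lam_injective (hα : ∀ k, α k ∈ Icc (0 : ℝ) 1) {δ : ℝ} (hδ0 : 0 < δ) (hδ1 : δ ≤ 1 / 4)
    {z V W : Torus} (hV : V.1 ≠ z.1) (h : lam D α z δ V = lam D α z δ W) : V = W := by
  have h1 : V.1 = W.1 := by simpa using congrArg Prod.fst h
  have hd : 0 < ‖V.1 - z.1‖ := norm_pos_iff.2 (sub_ne_zero.2 hV)
  refine eq_of_forall_dist_le fun η hη => ?_
  obtain ⟨κ, hκ, hk⟩ := lam_inverse_equicontinuous (D := D) hα hd hη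
  refine (hk z δ hδ0 hδ1 V W le_rfl (by rw [h1]) ?_).le
  rwa [h, dist_self]

lemma exists_lam_eq (hα : ∀ k, α k ∈ Icc (0 : ℝ) 1) {δ : ℝ} (hδ0 : 0 < δ) (hδ1 : δ ≤ 1 / 4)
    (z w : Torus) : ∃ v : Torus, v.1 = w.1 ∧ lam D α z δ v = w := by
  obtain ⟨x, y⟩ := w
  obtain ⟨u, hu, rfl⟩ := exists_coord (D := D) hα (min_norm_mem hδ0 hδ1 (x - z.1)) y z.2
  exact ⟨(x, z.2 + (hMap D α δ u : ℝ)), rfl, lam_apply hα hδ0 hδ1 z x hu⟩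

/-- Two identified points lie on the central column, where the map is `h_δ(u) ↦ h_0(u)`. Off the
flat piece `[-1/2, 1/2]`, `h_0` is injective up to the gluing of `±3/4`, which is no identification
on the circle. -/
lemma lam_collapse (hα : ∀ k, α k ∈ Icc (0 : ℝ) 1) {δ : ℝ} (hδ0 : 0 < δ) (hδ1 : δ ≤ 1 / 4)
    {z V W : Torus} (hVW : V ≠ W) (h : lam D α z δ V = lam D α z δ W) : lam D α z δ V = z := by
  have h1 : V.1 = W.1 := by simpa using congrArg Prod.fst h
  have hV : V.1 = z.1 := by
    by_contra hV
    exact hVW (lam_injective hα hδ0 hδ1 hV h)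
  have hδ : δ ∈ Icc (0 : ℝ) (1 / 4) := ⟨hδ0.le, hδ1⟩
  have h0 : (0 : ℝ) ∈ Icc (0 : ℝ) (1 / 4) := ⟨le_rfl, by norm_num⟩
  obtain ⟨x, y⟩ := V
  obtain ⟨x', y'⟩ := W
  obtain rfl : x = z.1 := hV
  obtain rfl : z.1 = x' := h1
  obtain ⟨u, hu, rfl⟩ := exists_coord (D := D) hα hδ y z.2
  obtain ⟨u', hu', rfl⟩ := exists_coord (D := D) hα hδ y' z.2
  rw [lam_apply hα hδ0 hδ1 z _ hu, lam_apply hα hδ0 hδ1 z _ hu', sub_self, norm_zero,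
    min_eq_left hδ0.le] at h
  rw [lam_apply hα hδ0 hδ1 z _ hu, sub_self, norm_zero, min_eq_left hδ0.le]
  have hne : (hMap D α δ u : UnitAddCircle) ≠ hMap D α δ u' := fun e => hVW (by rw [e])
  have heq : (hMap D α 0 u : UnitAddCircle) = hMap D α 0 u' := by
    simpa using congrArg Prod.snd h
  suffices hflat : |u| ≤ 1 / 2 by
    rw [hMap_zero_of_abs_le D hα hflat]
    simp
  by_contra hflat
  apply hne
  have hval : ∀ v ∈ Icc (-(3 / 4) : ℝ) (3 / 4), (1 / 2 ≤ v ∧ hMap D α 0 v = 2 * v - 1) ∨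
      (v ≤ -(1 / 2) ∧ hMap D α 0 v = 2 * v + 1) ∨ (|v| ≤ 1 / 2 ∧ hMap D α 0 v = 0) := by
    intro v _
    by_cases a : 1 / 2 ≤ v
    · exact Or.inl ⟨a, hMap_of_ge D hα le_rfl one_pos (by linarith)⟩
    by_cases b : v ≤ -(1 / 2)
    · exact Or.inr (Or.inl ⟨b, hMap_of_le D hα le_rfl one_pos (by linarith)⟩)
    have : |v| ≤ 1 / 2 := abs_le.2 ⟨by linarith, by linarith⟩
    exact Or.inr (Or.inr ⟨this, hMap_zero_of_abs_le D hα this⟩)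
  have hu_abs : 1 / 2 < u ∨ u < -(1 / 2) := by
    rcases lt_abs.1 (not_le.1 hflat) with a | a
    · exact Or.inl a
    · exact Or.inr (by linarith)
  have wrap : ∀ {a b : ℝ}, a = 3 / 4 → b = -(3 / 4) →
      (hMap D α δ a : UnitAddCircle) = hMap D α δ b := by
    rintro a b rfl rfl
    rw [hMap_three_quarters hα hδ, hMap_neg_three_quarters hα hδ, ← sub_eq_zero,
      ← AddCircle.coe_sub]
    norm_num
  have hcase := coe_eq_coe_of_mem (hMap_mem hα h0 hu) (hMap_mem hα h0 hu') heq
  rcases hval u hu with ⟨a, ea⟩ | ⟨a, ea⟩ | ⟨a, -⟩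
  · rcases hcase with e | ⟨e, e'⟩ | ⟨e, e'⟩
    · rcases hval u' hu' with ⟨b, eb⟩ | ⟨b, eb⟩ | ⟨b, eb⟩
      · rw [show u = u' by linarith]
      · rcases hu_abs with c | c <;> linarith
      · rcases hu_abs with c | c <;> linarith
    · rcases hval u' hu' with ⟨b, eb⟩ | ⟨b, eb⟩ | ⟨b, eb⟩
      · linarith
      · exact wrap (by linarith) (by linarith)
      · linarith
    · linarith
  · rcases hcase with e | ⟨e, e'⟩ | ⟨e, e'⟩
    · rcases hval u' hu' with ⟨b, eb⟩ | ⟨b, eb⟩ | ⟨b, eb⟩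
      · rcases hu_abs with c | c <;> linarith
      · rw [show u = u' by linarith]
      · rcases hu_abs with c | c <;> linarith
    · linarith
    · rcases hval u' hu' with ⟨b, eb⟩ | ⟨b, eb⟩ | ⟨b, eb⟩
      · exact (wrap (by linarith) (by linarith)).symm
      · linarith
      · linarith
  · exact absurd a hflat

lemma exists_ne_lam_eq (hα : ∀ k, α k ∈ Icc (0 : ℝ) 1) {δ : ℝ} (hδ0 : 0 < δ) (hδ1 : δ ≤ 1 / 4)
    (z : Torus) : ∃ V W : Torus, V.1 = z.1 ∧ W.1 = z.1 ∧ V ≠ W ∧ lam D α z δ V = z ∧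
      lam D α z δ W = z := by
  have hδ : δ ∈ Icc (0 : ℝ) (1 / 4) := ⟨hδ0.le, hδ1⟩
  have hu : (0 : ℝ) ∈ Icc (-(3 / 4) : ℝ) (3 / 4) := by constructor <;> norm_num
  have hu' : (1 / 4 : ℝ) ∈ Icc (-(3 / 4) : ℝ) (3 / 4) := by constructor <;> norm_num
  -- Any two coordinates in the flat piece `[-1/2, 1/2]` of `h_0` would do.
  refine ⟨(z.1, z.2 + (hMap D α δ 0 : ℝ)), (z.1, z.2 + (hMap D α δ (1 / 4) : ℝ)), rfl, rfl,
    ?_, ?_, ?_⟩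
  · intro h
    have h2 : (hMap D α δ 0 : UnitAddCircle) = hMap D α δ (1 / 4) := by
      simpa using congrArg Prod.snd h
    have hm := strictMono_hMap D hα hδ0 (by linarith)
    have a := hm (show (0 : ℝ) < 1 / 4 by norm_num)
    have b := hm (show (1 / 4 : ℝ) < 3 / 4 by norm_num)
    rw [hMap_three_quarters hα hδ] at b
    rcases coe_eq_coe_of_mem (hMap_mem hα hδ hu) (hMap_mem hα hδ hu') h2 with
      e | ⟨e, e'⟩ | ⟨e, e'⟩ <;> linarith
  · rw [lam_apply hα hδ0 hδ1 z _ hu, sub_self, norm_zero, min_eq_left hδ0.le,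
      hMap_zero_of_abs_le D hα (by norm_num)]
    simp
  · rw [lam_apply hα hδ0 hδ1 z _ hu', sub_self, norm_zero, min_eq_left hδ0.le,
      hMap_zero_of_abs_le D hα (by rw [abs_of_pos] <;> norm_num)]
    simp

/-- The map `(Λ^δ)⁻¹ ∘ Λ^δ'` with a common centre `z` is uniformly continuous off the fibre of
`z`. -/
lemma lam_symm_comp_equicontinuous (hα : ∀ k, α k ∈ Icc (0 : ℝ) 1) {δ δ' : ℝ} (hδ0 : 0 < δ)
    (hδ1 : δ ≤ 1 / 4) (hδ0' : 0 < δ') (hδ1' : δ' ≤ 1 / 4) (z : Torus) {η : ℝ} (hη : 0 < η) :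
    ∃ κ > 0, ∀ V W V' W' : Torus, V.1 ≠ z.1 → W.1 ≠ z.1 →
      lam D α z δ V' = lam D α z δ' V → lam D α z δ W' = lam D α z δ' W →
      dist V W < κ → dist V' W' < η := by
  set m := min δ δ' with hm
  have hm0 : 0 < m := lt_min hδ0 hδ0'
  obtain ⟨κ₁, hκ₁, h₁⟩ := hMap_equicontinuous (D := D) hα hδ0' hη
  obtain ⟨κ₂, hκ₂, h₂⟩ := lam_inverse_equicontinuous (D := D) hα (half_pos hm0) hη
  obtain ⟨κ₃, hκ₃, h₃⟩ := Metric.uniformContinuous_iff.1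
    (CompactSpace.uniformContinuous_of_continuous (lam_continuous (D := D) hα hδ0' hδ1' z)) κ₂ hκ₂
  refine ⟨min (min κ₁ η) (min κ₃ (m / 2)), by positivity, fun V W V' W' hV hW eV eW hVW => ?_⟩
  obtain ⟨⟨hk1, hk2⟩, hk3, hk4⟩ : (dist V W < κ₁ ∧ dist V W < η) ∧ dist V W < κ₃ ∧
      dist V W < m / 2 := by simpa [lt_min_iff] using hVW
  have fV : V'.1 = V.1 := by simpa using congrArg Prod.fst eV
  have fW : W'.1 = W.1 := by simpa using congrArg Prod.fst eW
  by_cases hfar : m / 2 ≤ ‖V.1 - z.1‖ ∧ m / 2 ≤ ‖W.1 - z.1‖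
  · refine h₂ z δ hδ0 hδ1 V' W' (by rw [fV]; exact hfar.1) (by rw [fW]; exact hfar.2) ?_
    rw [eV, eW]
    exact h₃ hk3
  · have hd : dist V.1 W.1 < m / 2 := (le_max_left _ _).trans_lt hk4
    have hnear : ‖V.1 - z.1‖ ≤ m ∧ ‖W.1 - z.1‖ ≤ m := by
      rw [← dist_eq_norm, ← dist_eq_norm] at hfar ⊢
      have t1 := dist_triangle V.1 W.1 z.1
      have t2 := dist_triangle W.1 V.1 z.1
      rw [dist_comm W.1 V.1] at t2
      by_cases a : m / 2 ≤ dist V.1 z.1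
      · have : ¬ m / 2 ≤ dist W.1 z.1 := fun b => hfar ⟨a, b⟩
        constructor <;> linarith
      · constructor <;> linarith
    -- Within distance `m` of the column both maps use the same parameter `‖x - z.1‖`, so it
    -- cancels: the coordinate `u` is kept and only the chart changes from `h_δ'` to `h_δ`.
    have key : ∀ A A' : Torus, A.1 ≠ z.1 → A'.1 = A.1 → ‖A.1 - z.1‖ ≤ m →
        lam D α z δ A' = lam D α z δ' A → ∃ u ∈ Icc (-(3 / 4) : ℝ) (3 / 4),
          A.2 = z.2 + (hMap D α δ' u : ℝ) ∧ A'.2 = z.2 + (hMap D α δ u : ℝ) := by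
      rintro ⟨x, y⟩ ⟨x', y'⟩ hne rfl hle e
      dsimp only at *
      obtain ⟨u, hu, rfl⟩ := exists_coord (D := D) hα ⟨hδ0'.le, hδ1'⟩ y z.2
      obtain ⟨u', hu', rfl⟩ := exists_coord (D := D) hα ⟨hδ0.le, hδ1⟩ y' z.2
      refine ⟨u, hu, rfl, ?_⟩
      have hpos : 0 < ‖x' - z.1‖ := norm_pos_iff.2 (sub_ne_zero.2 hne)
      have l1 : ‖x' - z.1‖ ≤ δ := hle.trans (min_le_left _ _)
      have l2 : ‖x' - z.1‖ ≤ δ' := hle.trans (min_le_right _ _)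
      rw [lam_apply hα hδ0 hδ1 z x' hu', lam_apply hα hδ0' hδ1' z x' hu, min_eq_left l1,
        min_eq_left l2] at e
      rw [coe_hMap_congr hα hpos (l1.trans hδ1) ⟨hδ0.le, hδ1⟩ hu' hu
        (by simpa using congrArg Prod.snd e)]
    obtain ⟨u, hu, a, b⟩ := key V V' hV fV hnear.1 eV
    obtain ⟨v, hv, a', b'⟩ := key W W' hW fW hnear.2 eW
    have hs : dist V.2 W.2 < κ₁ := (le_max_right _ _).trans_lt hk1
    have hf : dist V.1 W.1 < η := (le_max_left _ _).trans_lt hk2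
    rw [a, a', dist_add_left] at hs
    rw [Prod.dist_eq, max_lt_iff, fV, fW, b, b', dist_add_left]
    exact ⟨hf, h₁ δ' ⟨le_rfl, hδ1'⟩ δ' ⟨le_rfl, hδ1'⟩ δ ⟨hδ0.le, hδ1⟩ δ ⟨hδ0.le, hδ1⟩ u hu v hv
      (by simpa using hκ₁) (by simpa using hκ₁) hs⟩

end

section

/-! ### The flat distance -/

lemma dist_le_flatDist (v w : Torus) : dist v w ≤ flatDist v w := by
  unfold flatDist
  rw [Prod.dist_eq]
  refine max_le ?_ ?_ <;> refine Real.le_sqrt_of_sq_le ?_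
  · linarith [sq_nonneg (dist v.2 w.2)]
  · linarith [sq_nonneg (dist v.1 w.1)]

lemma flatDist_le_two_mul_dist (v w : Torus) : flatDist v w ≤ 2 * dist v w := by
  unfold flatDist
  have h1 : dist v.1 w.1 ≤ dist v w := le_max_left _ _
  have h2 : dist v.2 w.2 ≤ dist v w := le_max_right _ _
  have h3 := dist_nonneg (x := v.1) (y := w.1)
  have h4 := dist_nonneg (x := v.2) (y := w.2)
  refine Real.sqrt_le_iff.2 ⟨by positivity, ?_⟩
  nlinarith

lemma flatDist_nonneg (v w : Torus) : 0 ≤ flatDist v w := Real.sqrt_nonneg _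

lemma flatDist_pos {v w : Torus} (h : v ≠ w) : 0 < flatDist v w :=
  (dist_pos.2 h).trans_le (dist_le_flatDist v w)

lemma continuous_flatDist : Continuous fun p : Torus × Torus => flatDist p.1 p.2 := by
  unfold flatDist
  fun_prop

lemma flatDist_self (v : Torus) : flatDist v v = 0 := by simp [flatDist]

lemma sqrt_sq_add_sq_le (a b b' : ℝ) :
    Real.sqrt (a ^ 2 + b ^ 2) ≤ Real.sqrt (a ^ 2 + b' ^ 2) + |b - b'| := by
  have h0 := Real.sqrt_nonneg (a ^ 2 + b' ^ 2)
  refine Real.sqrt_le_iff.2 ⟨by positivity, ?_⟩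
  have h1 : Real.sqrt (a ^ 2 + b' ^ 2) ^ 2 = a ^ 2 + b' ^ 2 := Real.sq_sqrt (by positivity)
  have h2 : |b'| ≤ Real.sqrt (a ^ 2 + b' ^ 2) := Real.abs_le_sqrt (by nlinarith [sq_nonneg a])
  have h3 : |b - b'| ^ 2 = (b - b') ^ 2 := sq_abs _
  have h4 : b' * (b - b') ≤ |b'| * |b - b'| := by
    rw [← abs_mul]
    exact le_abs_self _
  have h5 : |b'| * |b - b'| ≤ Real.sqrt (a ^ 2 + b' ^ 2) * |b - b'| :=
    mul_le_mul_of_nonneg_right h2 (abs_nonneg _)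
  nlinarith

lemma flatDist_le_of_fst_eq {v w v' w' : Torus} (hv : v'.1 = v.1) (hw : w'.1 = w.1) :
    flatDist v w ≤ flatDist v' w' + (dist v'.2 v.2 + dist w'.2 w.2) := by
  have h : |dist v.2 w.2 - dist v'.2 w'.2| ≤ dist v'.2 v.2 + dist w'.2 w.2 := by
    have := dist_dist_dist_le v.2 w.2 v'.2 w'.2
    rwa [Real.dist_eq, dist_comm v.2 v'.2, dist_comm w.2 w'.2] at this
  unfold flatDist
  rw [hv, hw]
  exact (sqrt_sq_add_sq_le _ _ _).trans (by linarith)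

/-! ### Compositions of the maps `Λ` -/

/-- The composition `L (n - 1) ∘ ⋯ ∘ L 0`. -/
def compBelow (L : ℕ → Torus → Torus) : ℕ → Torus → Torus
  | 0 => id
  | n + 1 => L n ∘ compBelow L n

/-- Counting factors lets inductions start at the identity; hence `Φ_n` is the stage `n + 1` of
`lamComp`. -/
lemma compUpTo_eq (L : ℕ → Torus → Torus) (n : ℕ) : compUpTo L n = compBelow L (n + 1) := by
  induction n with
  | zero => rfl
  | succ n ih =>
    change L (n + 1) ∘ compUpTo L n = L (n + 1) ∘ compBelow L (n + 1)
    rw [ih]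

/-- The composition of the maps `Λ` with the first `n` of the centres `z` and the sizes `δ`. -/
def lamComp (D : StripData) (α : ℕ → ℝ) (z : ℕ → Torus) (δ : ℕ → ℝ) : ℕ → Torus → Torus :=
  compBelow fun k => lam D α (z k) (δ k)

variable {D : StripData} {α : ℕ → ℝ} {z : ℕ → Torus} {δ δ' : ℕ → ℝ}

lemma lamComp_zero (w : Torus) : lamComp D α z δ 0 w = w := rfl

lemma lamComp_succ (n : ℕ) (w : Torus) :
    lamComp D α z δ (n + 1) w = lam D α (z n) (δ n) (lamComp D α z δ n w) := rfl

@[simp] lemma lamComp_fst (n : ℕ) (w : Torus) : (lamComp D α z δ n w).1 = w.1 := by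
  induction n with
  | zero => rfl
  | succ n ih => rw [lamComp_succ, lam_fst, ih]

/-- The sizes that are allowed for the squares. -/
def SmallSizes (δ : ℕ → ℝ) : Prop := ∀ n, 0 < δ n ∧ δ n ≤ 1 / 4

lemma lamComp_continuous (hα : ∀ k, α k ∈ Icc (0 : ℝ) 1) (hδ : SmallSizes δ) (n : ℕ) :
    Continuous (lamComp D α z δ n) := by
  induction n with
  | zero => exact continuous_id
  | succ n ih => exact (lam_continuous hα (hδ n).1 (hδ n).2 (z n)).comp ih

lemma dist_lam_self_le (hα : ∀ k, α k ∈ Icc (0 : ℝ) 1) (hδ : SmallSizes δ) (n : ℕ) (x w : Torus) :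
    dist (lam D α x (δ n) w) w ≤ 2 * δ n := by
  rw [Prod.dist_eq, lam_fst, dist_self]
  exact max_le (by linarith [(hδ n).1]) (dist_lam_le hα (hδ n).1 (hδ n).2 x w)

lemma lamComp_succ_of_le (hα : ∀ k, α k ∈ Icc (0 : ℝ) 1) (hδ : SmallSizes δ) {n : ℕ} {w : Torus}
    (h : δ n ≤ ‖w.1 - (z n).1‖) : lamComp D α z δ (n + 1) w = lamComp D α z δ n w := by
  rw [lamComp_succ]
  exact lam_of_le_norm hα (hδ n).1 (hδ n).2 (by rwa [lamComp_fst])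

/-- The quantifier order matters: `κ` precedes `δ`, so the later thresholds do not depend on the
sizes of earlier squares. -/
lemma lamComp_inverse_equicontinuous (hα : ∀ k, α k ∈ Icc (0 : ℝ) 1) (z : ℕ → Torus) (n : ℕ)
    {d η : ℝ} (hd : 0 < d) (hη : 0 < η) :
    ∃ κ > 0, ∀ δ, SmallSizes δ → ∀ V W : Torus,
      (∀ k < n, d ≤ ‖V.1 - (z k).1‖ ∧ d ≤ ‖W.1 - (z k).1‖) →
      dist (lamComp D α z δ n V) (lamComp D α z δ n W) < κ → dist V W < η := by
  induction n generalizing η with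
  | zero => exact ⟨η, hη, fun δ _ V W _ h => h⟩
  | succ n ih =>
    obtain ⟨κ₁, hκ₁, h₁⟩ := ih hη
    obtain ⟨κ₂, hκ₂, h₂⟩ := lam_inverse_equicontinuous (D := D) hα hd hκ₁
    refine ⟨κ₂, hκ₂, fun δ hδ V W hVW h => ?_⟩
    refine h₁ δ hδ V W (fun k hk => hVW k (by omega)) ?_
    exact h₂ (z n) (δ n) (hδ n).1 (hδ n).2 _ _ (by simpa using (hVW n (by omega)).1)
      (by simpa using (hVW n (by omega)).2) h

lemma lamComp_injective (hα : ∀ k, α k ∈ Icc (0 : ℝ) 1) (hδ : SmallSizes δ) {n : ℕ} {V W : Torus}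
    (hV : ∀ k < n, V.1 ≠ (z k).1) (h : lamComp D α z δ n V = lamComp D α z δ n W) : V = W := by
  induction n with
  | zero => exact h
  | succ n ih =>
    exact ih (fun k hk => hV k (by omega))
      (lam_injective hα (hδ n).1 (hδ n).2 (by simpa using hV n (by omega)) h)

lemma exists_lamComp_eq (hα : ∀ k, α k ∈ Icc (0 : ℝ) 1) (hδ : SmallSizes δ) (n : ℕ) (w : Torus) :
    ∃ v : Torus, v.1 = w.1 ∧ lamComp D α z δ n v = w := by
  induction n generalizing w with
  | zero => exact ⟨w, rfl, rfl⟩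
  | succ n ih =>
    obtain ⟨u, hu, rfl⟩ := exists_lam_eq (D := D) hα (hδ n).1 (hδ n).2 (z n) w
    obtain ⟨v, hv, rfl⟩ := ih u
    exact ⟨v, by simp, rfl⟩

lemma lamComp_bijOn (hα : ∀ k, α k ∈ Icc (0 : ℝ) 1) (hδ : SmallSizes δ) (n : ℕ) {X : Set Torus}
    (hX : ∀ w ∈ X, ∀ k, w.1 ≠ (z k).1) (hX' : ∀ v w : Torus, v.1 = w.1 → v ∈ X → w ∈ X) :
    BijOn (lamComp D α z δ n) X X := by
  refine ⟨fun w hw => hX' w _ (by simp) hw, fun v hv w _ h => ?_, fun w hw => ?_⟩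
  · exact lamComp_injective hα hδ (fun k _ => hX v hv k) h
  · obtain ⟨v, hv, h⟩ := exists_lamComp_eq (D := D) (z := z) hα hδ n w
    exact ⟨v, hX' w v hv.symm hw, h⟩

/-! ### Thresholds -/

lemma exists_gap (z : ℕ → Torus) (x : UnitAddCircle) (N : ℕ) :
    ∃ g > 0, ∀ j < N, x ≠ (z j).1 → g ≤ ‖x - (z j).1‖ := by
  induction N with
  | zero => exact ⟨1, one_pos, fun j hj => absurd hj (by omega)⟩
  | succ N ih =>
    obtain ⟨g, hg, h⟩ := ih
    by_cases hN : x = (z N).1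
    · refine ⟨g, hg, fun j hj hne => ?_⟩
      have : j ≠ N := fun e => hne (by rw [e, hN])
      exact h j (by omega) hne
    · refine ⟨min g ‖x - (z N).1‖, lt_min hg (norm_pos_iff.2 (sub_ne_zero.2 hN)),
        fun j hj hne => ?_⟩
      rcases (show j < N ∨ j = N by omega) with hj | rfl
      · exact (min_le_left _ _).trans (h j hj hne)
      · exact min_le_right _ _

lemma norm_sub_ge {g a : ℝ} {x y v : UnitAddCircle} (h : g ≤ ‖x - y‖) (hv : ‖v - x‖ ≤ a) :
    g - a ≤ ‖v - y‖ := by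
  have := norm_sub_le_norm_sub_add_norm_sub x v y
  rw [norm_sub_rev x v] at this
  linarith

/-- If neither point is in the strip of column `n`, nothing moves. Otherwise the stage-`n` images
are a definite distance apart: by the inverse modulus when both points are near column `n`, hence
far from earlier columns, and by their horizontal distance when one is not. A displacement of at
most `2 * δ n` for each is then a small relative loss. -/
lemma exists_separation_threshold (hα : ∀ k, α k ∈ Icc (0 : ℝ) 1)
    (hz : Function.Injective fun n => (z n).1) (n : ℕ) {s b : ℝ} (hs : 0 < s) (hb : 0 < b) :
    ∃ ε > 0, ∀ δ, SmallSizes δ → δ n < ε → ∀ V W : Torus, s ≤ flatDist V W →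
      (1 - b) * flatDist (lamComp D α z δ n V) (lamComp D α z δ n W) ≤
        flatDist (lamComp D α z δ (n + 1) V) (lamComp D α z δ (n + 1) W) := by
  obtain ⟨g, hg, hgap⟩ := exists_gap z (z n).1 n
  obtain ⟨κ, hκ, hE⟩ := lamComp_inverse_equicontinuous (D := D) hα z n (half_pos hg) (half_pos hs)
  have hκ' : 0 < min κ (g / 4) := lt_min hκ (by positivity)
  refine ⟨min (g / 4) (b * min κ (g / 4) / 4), by positivity, fun δ hδ hε V W hVW => ?_⟩
  rw [lt_min_iff] at hε
  obtain ⟨hε₁, hε₂⟩ := hε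
  have hnn := flatDist_nonneg (lamComp D α z δ n V) (lamComp D α z δ n W)
  by_cases hout : δ n ≤ ‖V.1 - (z n).1‖ ∧ δ n ≤ ‖W.1 - (z n).1‖
  · rw [lamComp_succ_of_le hα hδ hout.1, lamComp_succ_of_le hα hδ hout.2]
    nlinarith
  have hfar : min κ (g / 4) ≤ dist (lamComp D α z δ n V) (lamComp D α z δ n W) := by
    by_cases hin : ‖V.1 - (z n).1‖ ≤ g / 2 ∧ ‖W.1 - (z n).1‖ ≤ g / 2
    · refine (min_le_left _ _).trans (not_lt.1 fun hlt => ?_)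
      have := hE δ hδ V W (fun k hk => ?_) hlt
      · linarith [flatDist_le_two_mul_dist V W]
      · have hk' := hgap k hk fun e => absurd (hz e) (by omega)
        exact ⟨by linarith [norm_sub_ge hk' hin.1], by linarith [norm_sub_ge hk' hin.2]⟩
    · refine (min_le_right _ _).trans (le_trans ?_ (le_max_left _ _))
      rw [lamComp_fst, lamComp_fst]
      rw [← dist_eq_norm, ← dist_eq_norm] at hin hout
      have t1 := dist_triangle V.1 W.1 (z n).1
      have t2 := dist_triangle W.1 V.1 (z n).1
      rw [dist_comm W.1 V.1] at t2
      by_cases a : δ n ≤ dist V.1 (z n).1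
      · have a' : dist W.1 (z n).1 < δ n := not_le.1 fun h => hout ⟨a, h⟩
        have b' : g / 2 < dist V.1 (z n).1 := not_le.1 fun h => hin ⟨h, by linarith⟩
        linarith
      · rw [not_le] at a
        have b' : g / 2 < dist W.1 (z n).1 := not_le.1 fun h => hin ⟨by linarith, h⟩
        linarith
  have h1 := hfar.trans (dist_le_flatDist _ _)
  have h2 := flatDist_le_of_fst_eq (v := lamComp D α z δ n V) (w := lamComp D α z δ n W)
    (v' := lamComp D α z δ (n + 1) V) (w' := lamComp D α z δ (n + 1) W) (by simp) (by simp)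
  have h3 := dist_lam_le (D := D) hα (hδ n).1 (hδ n).2 (z n) (lamComp D α z δ n V)
  have h4 := dist_lam_le (D := D) hα (hδ n).1 (hδ n).2 (z n) (lamComp D α z δ n W)
  rw [← lamComp_succ] at h3 h4
  have h5 := mul_le_mul_of_nonneg_left h1 hb.le
  linarith

lemma lam_add (x : Torus) (s : ℝ) (w e : Torus) :
    lam D α (x + e) s (w + e) = lam D α x s w + e := by
  have hmem : w + e ∈ square (x + e) s ↔ w ∈ square x s := by
    rw [mem_square, mem_square]
    simp
  unfold lam
  by_cases h : w ∈ square x s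
  · rw [if_pos h, if_pos (hmem.2 h)]
    ext
    · rfl
    · simp only [Prod.snd_add, Prod.fst_add, add_sub_add_right_eq_sub]
      abel
  · rw [if_neg h, if_neg (mt hmem.1 h)]

lemma lamComp_conj_succ {e : Torus} {n : ℕ} {V V' : Torus}
    (h : lamComp D α (fun k => z k + e) δ' (n + 1) V' = lamComp D α z δ (n + 1) V + e) :
    lam D α (z n + e) (δ' n) (lamComp D α (fun k => z k + e) δ' n V') =
      lam D α (z n + e) (δ n) (lamComp D α z δ n V + e) := by
  rw [lam_add]
  exact h

lemma fst_of_conj {e : Torus} {n : ℕ} {V V' : Torus}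
    (h : lamComp D α (fun k => z k + e) δ' n V' = lamComp D α z δ n V + e) :
    V'.1 = V.1 + e.1 := by
  simpa using congrArg Prod.fst h

/-- `A` and `B` are the values at `w` of two consecutive conjugated maps. Off the strips of column
`n` they coincide. Inside, their images under the stage-`n` composition differ by at most `2 * δ n +
2 * δ' n`, and the inverse modulus applies because the earlier columns are far away. -/
lemma exists_cauchy_threshold (hα : ∀ k, α k ∈ Icc (0 : ℝ) 1)
    (hz : Function.Injective fun n => (z n).1) (e : Torus) (n : ℕ) {η : ℝ} (hη : 0 < η) :
    ∃ ε > 0, ∀ δ δ', SmallSizes δ → SmallSizes δ' → δ n < ε → δ' n < ε → ∀ w A B : Torus,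
      (∀ k, w.1 ≠ (z k).1) →
      lamComp D α (fun k => z k + e) δ' n A = lamComp D α z δ n w + e →
      lamComp D α (fun k => z k + e) δ' (n + 1) B = lamComp D α z δ (n + 1) w + e →
      dist A B < η := by
  obtain ⟨g, hg, hgap⟩ := exists_gap z (z n).1 n
  obtain ⟨κ, hκ, hE⟩ := lamComp_inverse_equicontinuous (D := D) hα (fun k => z k + e) n
    (half_pos hg) hη
  refine ⟨min (g / 2) (κ / 4), by positivity, fun δ δ' hδ hδ' hε hε' w A B hw hA hB => ?_⟩
  rw [lt_min_iff] at hε hε'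
  have fA := fst_of_conj hA
  have fB := fst_of_conj hB
  have shift : ∀ k, ‖w.1 + e.1 - (z k + e).1‖ = ‖w.1 - (z k).1‖ := fun k => by simp
  by_cases hout : δ n ≤ ‖w.1 - (z n).1‖ ∧ δ' n ≤ ‖w.1 - (z n).1‖
  · rw [lamComp_succ_of_le hα hδ hout.1, lamComp_succ_of_le hα hδ' (by rw [fB, shift]; exact hout.2),
      ← hA] at hB
    rw [lamComp_injective hα hδ' (fun k _ => ?_) hB, dist_self]
    · exact hη
    · rw [fB]
      simpa using hw k
  · have hin : ‖w.1 - (z n).1‖ ≤ g / 2 := by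
      by_contra hlt
      exact hout ⟨by linarith [hε.1], by linarith [hε'.1]⟩
    refine hE δ' hδ' A B (fun k hk => ?_) ?_
    · have hk' := hgap k hk fun e => absurd (hz e) (by omega)
      rw [fA, fB, shift]
      have := norm_sub_ge hk' hin
      exact ⟨by linarith, by linarith⟩
    · have h1 := dist_lam_self_le (D := D) hα hδ' n (z n + e)
        (lamComp D α (fun k => z k + e) δ' n B)
      have h2 := dist_lam_self_le (D := D) hα hδ n (z n) (lamComp D α z δ n w)
      rw [← lamComp_succ (z := fun k => z k + e), hB] at h1
      rw [← lamComp_succ, ← dist_add_right _ _ e] at h2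
      rw [hA]
      refine (dist_triangle_left _ _ _).trans_lt (add_lt_add_of_le_of_lt h2
        (h1.trans_lt (b := 2 * δ' n) (c := κ / 2) (by linarith [hε'.2]))) |>.trans_le ?_
      linarith [hε.2]

/-- Induction on the columns. Away from the strips of the last column its two factors are
identities. Near it the quotient of these factors is uniformly continuous, and what remains to be
inverted involves only columns at distance at least `2 * m`. -/
lemma conj_equicontinuous (hα : ∀ k, α k ∈ Icc (0 : ℝ) 1) (e : Torus) (hδ : SmallSizes δ)
    (hδ' : SmallSizes δ') (hgap : ∀ n, ∀ k < n, 4 * δ n ≤ ‖(z n).1 - (z k).1‖)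
    (hgap' : ∀ n, ∀ k < n, 4 * δ' n ≤ ‖(z n).1 - (z k).1‖) (n : ℕ) {η : ℝ} (hη : 0 < η) :
    ∃ κ > 0, ∀ V W V' W' : Torus, (∀ k, V.1 ≠ (z k).1) → (∀ k, W.1 ≠ (z k).1) →
      lamComp D α (fun k => z k + e) δ' n V' = lamComp D α z δ n V + e →
      lamComp D α (fun k => z k + e) δ' n W' = lamComp D α z δ n W + e →
      dist V W < κ → dist V' W' < η := by
  induction n with
  | zero =>
    refine ⟨η, hη, fun V W V' W' _ _ hV hW h => ?_⟩
    rw [lamComp_zero, lamComp_zero] at hV hW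
    rwa [hV, hW, dist_add_right]
  | succ n ih =>
    set m := max (δ n) (δ' n) with hm
    have hm0 : 0 < m := lt_max_of_lt_left (hδ n).1
    have hgm : ∀ k < n, 4 * m ≤ ‖(z n).1 - (z k).1‖ := fun k hk => by
      rw [hm]
      rcases max_choice (δ n) (δ' n) with h | h <;> rw [h]
      exacts [hgap n k hk, hgap' n k hk]
    obtain ⟨κ₁, hκ₁, h₁⟩ := lamComp_inverse_equicontinuous (D := D) hα (fun k => z k + e) n
      (show 0 < 2 * m by positivity) hη
    obtain ⟨κ₂, hκ₂, h₂⟩ := lam_symm_comp_equicontinuous (D := D) hα (hδ' n).1 (hδ' n).2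
      (hδ n).1 (hδ n).2 (z n + e) hκ₁
    obtain ⟨κ₃, hκ₃, h₃⟩ := Metric.uniformContinuous_iff.1
      (CompactSpace.uniformContinuous_of_continuous
        (lamComp_continuous (D := D) (z := z) hα hδ n)) κ₂ hκ₂
    obtain ⟨κ₄, hκ₄, h₄⟩ := ih
    refine ⟨min m (min κ₃ κ₄), by positivity, fun V W V' W' hV hW eV eW hVW => ?_⟩
    rw [lt_min_iff, lt_min_iff] at hVW
    obtain ⟨hd, hd₃, hd₄⟩ := hVW
    have fV := fst_of_conj eV
    have fW := fst_of_conj eW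
    have shift : ∀ (x : UnitAddCircle) k, ‖x + e.1 - (z k + e).1‖ = ‖x - (z k).1‖ :=
      fun x k => by simp
    by_cases hout : m ≤ ‖V.1 - (z n).1‖ ∧ m ≤ ‖W.1 - (z n).1‖
    · have red : ∀ A A' : Torus, m ≤ ‖A.1 - (z n).1‖ → A'.1 = A.1 + e.1 →
          lamComp D α (fun k => z k + e) δ' (n + 1) A' = lamComp D α z δ (n + 1) A + e →
          lamComp D α (fun k => z k + e) δ' n A' = lamComp D α z δ n A + e := by
        intro A A' hA fA eA
        rwa [lamComp_succ_of_le hα hδ ((le_max_left _ _).trans hA), lamComp_succ_of_le hα hδ'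
          (by rw [fA, shift]; exact (le_max_right _ _).trans hA)] at eA
      exact h₄ V W V' W' hV hW (red V V' hout.1 fV eV) (red W W' hout.2 fW eW) hd₄
    · have hin : ‖V.1 - (z n).1‖ ≤ 2 * m ∧ ‖W.1 - (z n).1‖ ≤ 2 * m := by
        have hd' : dist V.1 W.1 < m := (le_max_left _ _).trans_lt hd
        rw [← dist_eq_norm, ← dist_eq_norm] at hout ⊢
        have t1 := dist_triangle V.1 W.1 (z n).1
        have t2 := dist_triangle W.1 V.1 (z n).1
        rw [dist_comm W.1 V.1] at t2
        by_cases a : m ≤ dist V.1 (z n).1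
        · have a' : dist W.1 (z n).1 < m := not_le.1 fun h => hout ⟨a, h⟩
          constructor <;> linarith
        · constructor <;> linarith
      refine h₁ δ' hδ' V' W' (fun k hk => ?_) ?_
      · rw [fV, fW, shift, shift]
        exact ⟨by linarith [norm_sub_ge (hgm k hk) hin.1],
          by linarith [norm_sub_ge (hgm k hk) hin.2]⟩
      · refine h₂ _ _ _ _ ?_ ?_ (lamComp_conj_succ eV) (lamComp_conj_succ eW) ?_
        · simpa using hV n
        · simpa using hW n
        · rw [dist_add_right]
          exact h₃ hd₃

end

/-! ### The rotation and its orbit -/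

lemma rot_apply (c w : Torus) : rot c w = w + c := rfl

lemma rot_symm_apply (c w : Torus) : (rot c).symm w = w + -c := rfl

lemma rot_zpow_apply (c w : Torus) (k : ℤ) : (rot c ^ k) w = w + k • c := by
  induction k using Int.induction_on with
  | zero => simp
  | succ k ih =>
    rw [add_comm, zpow_add, zpow_one, Homeomorph.mul_apply, ih, rot_apply, add_zsmul, one_zsmul]
    abel
  | pred k ih =>
    have h : (rot c ^ (-(k : ℤ) - 1)) w = (rot c).symm ((rot c ^ (-(k : ℤ))) w) := by
      rw [sub_eq_neg_add, zpow_add, zpow_neg_one]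
      rfl
    rw [h, ih, rot_symm_apply, sub_zsmul, one_zsmul]
    abel

lemma orbitIndex_injective : Function.Injective orbitIndex := by
  intro m n h
  unfold orbitIndex at h
  grind

/-- A coincidence would make `c.1` a torsion element of some order dividing `k ≠ 0`, and the orbit
of `0` would stay in the proper closed set `k • w.1 = 0`. -/
lemma orbitPt_fst_injective {c : Torus} (hT : IsMinimalHomeo (rot c)) (z₀ : Torus) :
    Function.Injective fun n => (orbitPt c z₀ n).1 := by
  intro m n h
  by_contra hmn
  set k := orbitIndex m - orbitIndex n with hk
  have hk0 : k ≠ 0 := sub_ne_zero.2 fun e => hmn (orbitIndex_injective e)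
  have hkc : k • c.1 = 0 := by
    have h' : (z₀ + orbitIndex m • c).1 = (z₀ + orbitIndex n • c).1 := by
      rw [← rot_zpow_apply, ← rot_zpow_apply]
      exact h
    rw [hk, sub_zsmul]
    simpa [add_neg_eq_zero] using h'
  have hall : ∀ w : Torus, k • w.1 = 0 := by
    have hclosed : IsClosed {w : Torus | k • w.1 = 0} :=
      isClosed_eq (by fun_prop) continuous_const
    have hsub : range (fun j : ℤ => (rot c ^ j) (0 : Torus)) ⊆ {w : Torus | k • w.1 = 0} := by
      rintro _ ⟨j, rfl⟩
      change k • ((rot c ^ j) (0 : Torus)).1 = 0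
      rw [rot_zpow_apply, zero_add, Prod.smul_fst, smul_comm, hkc, smul_zero]
    intro w
    exact hclosed.closure_subset_iff.2 hsub (hT 0 w)
  have hk0' : (k : ℝ) ≠ 0 := Int.cast_ne_zero.2 hk0
  -- A point outside that set: its `k`-th multiple is `1/2`, of norm `1/2`.
  have h2 := hall (((1 / 2 / k : ℝ) : UnitAddCircle), 0)
  dsimp only at h2
  rw [← AddCircle.coe_zsmul, zsmul_eq_mul, mul_div_cancel₀ _ hk0'] at h2
  have h3 := norm_coe_of_abs_le (show |(1 / 2 : ℝ)| ≤ 1 / 2 by rw [abs_of_pos (by norm_num)])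
  rw [h2, norm_zero, abs_of_pos (by norm_num)] at h3
  norm_num at h3

lemma sigma_tau (n : ℕ) : sigma (tau n) = n :=
  orbitIndex_injective (by rw [orbitIndex_sigma, orbitIndex_tau]; ring)

lemma tau_sigma (n : ℕ) : tau (sigma n) = n :=
  orbitIndex_injective (by rw [orbitIndex_tau, orbitIndex_sigma]; ring)

lemma sigma_le_sigma_add {k n : ℕ} (h : k < n) : sigma k ≤ sigma n + 3 := by
  unfold sigma
  grind

lemma tau_le_tau_add {k n : ℕ} (h : k < n) : tau k ≤ tau n + 3 := by
  unfold tau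
  grind

lemma goodSet_congr (c z₀ : Torus) {v w : Torus} (h : v.1 = w.1) (hv : v ∈ goodSet c z₀) :
    w ∈ goodSet c z₀ := fun n => by
  rw [← h]
  exact hv n

lemma rot_mem_goodSet {c z₀ w : Torus} (hw : w ∈ goodSet c z₀) : rot c w ∈ goodSet c z₀ := by
  intro n h
  apply hw (tau n)
  rw [← rot_symm_orbitPt, rot_symm_apply, Prod.fst_add, ← h, ← Prod.fst_add, ← rot_symm_apply,
    Homeomorph.symm_apply_apply]

lemma rot_symm_mem_goodSet {c z₀ w : Torus} (hw : w ∈ goodSet c z₀) :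
    (rot c).symm w ∈ goodSet c z₀ := by
  intro n h
  apply hw (sigma n)
  rw [← rot_orbitPt, rot_apply, Prod.fst_add, ← h, ← Prod.fst_add, ← rot_apply,
    Homeomorph.apply_symm_apply]

lemma dense_goodSet (c z₀ : Torus) : Dense (goodSet c z₀) := by
  set S : Set UnitAddCircle := range fun n => (orbitPt c z₀ n).1 with hS
  have hcount : ((fun x : ℝ => (x : UnitAddCircle)) ⁻¹' S).Countable := by
    refine (countable_range fun p : ℕ × ℤ => rep (orbitPt c z₀ p.1).1 + p.2).mono ?_
    rintro x ⟨n, hn⟩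
    have h : ((x - rep (orbitPt c z₀ n).1 : ℝ) : UnitAddCircle) = 0 := by
      rw [AddCircle.coe_sub, coe_rep, sub_eq_zero]
      exact hn.symm
    obtain ⟨m, hm⟩ := (AddCircle.coe_eq_zero_iff 1).1 h
    rw [zsmul_eq_mul, mul_one] at hm
    exact ⟨(n, m), by dsimp only; linarith⟩
  have hsurj : Function.Surjective fun x : ℝ => (x : UnitAddCircle) :=
    fun θ => ⟨rep θ, coe_rep θ⟩
  have hd : Dense Sᶜ := by
    refine (hsurj.denseRange.dense_image (AddCircle.continuous_mk' 1)
      (hcount.dense_compl ℝ)).mono ?_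
    rintro _ ⟨x, hx, rfl⟩
    exact hx
  have : goodSet c z₀ = Sᶜ ×ˢ univ := by
    ext w
    simp [goodSet, hS, eq_comm]
  rw [this]
  exact hd.prod dense_univ

lemma conjOn_spec {X : Set Torus} {G F : Torus → Torus} {R : Torus → Torus} (hG : BijOn G X X)
    (hF : MapsTo F X X) (hR : MapsTo R X X) {w : Torus} (hw : w ∈ X) :
    conjOn X G R F w ∈ X ∧ G (conjOn X G R F w) = R (F w) := by
  have h : ∃ v ∈ X, G v = R (F w) := hG.surjOn (hR (hF hw))
  exact ⟨Function.invFunOn_mem h, Function.invFunOn_eq h⟩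

/-! ### Reordering the compositions -/

section Reorder

variable {L : ℕ → Torus → Torus}

/-- `σ` maps `{0, …, 2j+1}` onto `{0, …, 2j} ∪ {2j+2}`. Sorting the factors inductively swaps only
indices at distance at most `3`. -/
lemma compUpTo_sigma (hL : ∀ j k, j ≤ k + 3 → k ≤ j + 3 → ∀ w, L j (L k w) = L k (L j w))
    (j : ℕ) (w : Torus) : compUpTo (fun k => L (sigma k)) (2 * j + 1) w =
      L (2 * j + 2) (compUpTo L (2 * j) w) := by
  induction j with
  | zero => exact hL 0 2 (by omega) (by omega) w
  | succ j ih =>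
    have s1 : sigma (2 * j + 1 + 1) = 2 * j + 4 := by unfold sigma; grind
    have s2 : sigma (2 * j + 1 + 1 + 1) = 2 * j + 1 := by unfold sigma; grind
    change L (sigma (2 * j + 1 + 1 + 1)) (L (sigma (2 * j + 1 + 1))
      (compUpTo (fun k => L (sigma k)) (2 * j + 1) w)) =
        L (2 * j + 4) (L (2 * j + 2) (L (2 * j + 1) (compUpTo L (2 * j) w)))
    rw [ih, s1, s2, hL (2 * j + 1) (2 * j + 4) (by omega) (by omega),
      hL (2 * j + 1) (2 * j + 2) (by omega) (by omega)]

lemma compUpTo_tau (hL : ∀ j k, j ≤ k + 3 → k ≤ j + 3 → ∀ w, L j (L k w) = L k (L j w))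
    (j : ℕ) (w : Torus) : compUpTo (fun k => L (tau k)) (2 * j + 2) w =
      L (2 * j + 3) (compUpTo L (2 * j + 1) w) := by
  induction j with
  | zero =>
    change L 0 (L 3 (L 1 w)) = L 3 (L 1 (L 0 w))
    rw [hL 0 3 (by omega) (by omega), hL 0 1 (by omega) (by omega)]
  | succ j ih =>
    have s1 : tau (2 * j + 2 + 1) = 2 * j + 5 := by unfold tau; grind
    have s2 : tau (2 * j + 2 + 1 + 1) = 2 * j + 2 := by unfold tau; grind
    change L (tau (2 * j + 2 + 1 + 1)) (L (tau (2 * j + 2 + 1))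
      (compUpTo (fun k => L (tau k)) (2 * j + 2) w)) =
        L (2 * j + 5) (L (2 * j + 3) (L (2 * j + 2) (compUpTo L (2 * j + 1) w)))
    rw [ih, s1, s2, hL (2 * j + 2) (2 * j + 5) (by omega) (by omega),
      hL (2 * j + 2) (2 * j + 3) (by omega) (by omega)]

/-- Once sorted, the two compositions share an initial block and differ only in at most four outer
factors, all of index at least `n`. -/
lemma dist_compUpTo_sigma_le
    (hL : ∀ j k, j ≤ k + 3 → k ≤ j + 3 → ∀ w, L j (L k w) = L k (L j w))
    (hd : ∀ n w, dist (L n w) w ≤ (1 / 2) ^ n) (n : ℕ) (w : Torus) :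
    dist (compUpTo (fun k => L (sigma k)) (n + 1) w) (compUpTo L (n + 1) w) ≤
      4 * (1 / 2) ^ n := by
  have hp : (0 : ℝ) < (1 / 2) ^ n := by positivity
  rcases Nat.even_or_odd' n with ⟨j, rfl | rfl⟩
  · rw [compUpTo_sigma hL]
    have h1 := hd (2 * j + 2) (compUpTo L (2 * j) w)
    have h2 := hd (2 * j + 1) (compUpTo L (2 * j) w)
    have h3 := dist_triangle_right (L (2 * j + 2) (compUpTo L (2 * j) w))
      (L (2 * j + 1) (compUpTo L (2 * j) w)) (compUpTo L (2 * j) w)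
    change dist _ (L (2 * j + 1) (compUpTo L (2 * j) w)) ≤ _
    rw [pow_succ, pow_succ] at h1
    rw [pow_succ] at h2
    linarith
  · have s1 : sigma (2 * j + 1 + 1) = 2 * j + 4 := by unfold sigma; grind
    change dist (L (sigma (2 * j + 1 + 1)) (compUpTo (fun k => L (sigma k)) (2 * j + 1) w))
      (L (2 * j + 2) (L (2 * j + 1) (compUpTo L (2 * j) w))) ≤ _
    rw [compUpTo_sigma hL, s1]
    set y := compUpTo L (2 * j) w
    have h1 := hd (2 * j + 4) (L (2 * j + 2) y)
    have h2 := hd (2 * j + 2) y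
    have h3 := hd (2 * j + 2) (L (2 * j + 1) y)
    have h4 := hd (2 * j + 1) y
    have t1 := dist_triangle (L (2 * j + 4) (L (2 * j + 2) y)) (L (2 * j + 2) y) y
    have t2 := dist_triangle (L (2 * j + 2) (L (2 * j + 1) y)) (L (2 * j + 1) y) y
    have t3 := dist_triangle_right (L (2 * j + 4) (L (2 * j + 2) y))
      (L (2 * j + 2) (L (2 * j + 1) y)) y
    have e2 : (1 / 2 : ℝ) ^ (2 * j + 2) = (1 / 2) ^ (2 * j + 1) / 2 := by ring
    have e4 : (1 / 2 : ℝ) ^ (2 * j + 4) = (1 / 2) ^ (2 * j + 1) / 8 := by ring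
    rw [e2] at h2 h3
    rw [e4] at h1
    linarith

lemma dist_compUpTo_tau_le
    (hL : ∀ j k, j ≤ k + 3 → k ≤ j + 3 → ∀ w, L j (L k w) = L k (L j w))
    (hd : ∀ n w, dist (L n w) w ≤ (1 / 2) ^ n) (n : ℕ) (w : Torus) :
    dist (compUpTo (fun k => L (tau k)) (n + 2) w) (compUpTo L (n + 2) w) ≤
      4 * (1 / 2) ^ n := by
  have hp : (0 : ℝ) < (1 / 2) ^ n := by positivity
  rcases Nat.even_or_odd' n with ⟨j, rfl | rfl⟩
  · rw [compUpTo_tau hL]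
    change dist _ (L (2 * j + 2) (compUpTo L (2 * j + 1) w)) ≤ _
    set y := compUpTo L (2 * j + 1) w
    have h1 := hd (2 * j + 3) y
    have h2 := hd (2 * j + 2) y
    have h3 := dist_triangle_right (L (2 * j + 3) y) (L (2 * j + 2) y) y
    have e2 : (1 / 2 : ℝ) ^ (2 * j + 2) = (1 / 2) ^ (2 * j) / 4 := by ring
    have e4 : (1 / 2 : ℝ) ^ (2 * j + 3) = (1 / 2) ^ (2 * j) / 8 := by ring
    rw [e4] at h1
    rw [e2] at h2
    linarith
  · have s1 : tau (2 * j + 2 + 1) = 2 * j + 5 := by unfold tau; grind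
    change dist (L (tau (2 * j + 2 + 1)) (compUpTo (fun k => L (tau k)) (2 * j + 2) w))
      (L (2 * j + 3) (L (2 * j + 2) (compUpTo L (2 * j + 1) w))) ≤ _
    rw [compUpTo_tau hL, s1]
    set y := compUpTo L (2 * j + 1) w
    have h1 := hd (2 * j + 5) (L (2 * j + 3) y)
    have h2 := hd (2 * j + 3) y
    have h3 := hd (2 * j + 3) (L (2 * j + 2) y)
    have h4 := hd (2 * j + 2) y
    have t1 := dist_triangle (L (2 * j + 5) (L (2 * j + 3) y)) (L (2 * j + 3) y) y
    have t2 := dist_triangle (L (2 * j + 3) (L (2 * j + 2) y)) (L (2 * j + 2) y) y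
    have t3 := dist_triangle_right (L (2 * j + 5) (L (2 * j + 3) y))
      (L (2 * j + 3) (L (2 * j + 2) y)) y
    have e2 : (1 / 2 : ℝ) ^ (2 * j + 2) = (1 / 2) ^ (2 * j + 1) / 2 := by ring
    have e3 : (1 / 2 : ℝ) ^ (2 * j + 3) = (1 / 2) ^ (2 * j + 1) / 4 := by ring
    have e5 : (1 / 2 : ℝ) ^ (2 * j + 5) = (1 / 2) ^ (2 * j + 1) / 16 := by ring
    rw [e2] at h4
    rw [e3] at h2 h3
    rw [e5] at h1
    linarith

end Reorder

/-! ### Limits -/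

lemma exists_tendstoUniformlyOn {X E : Type*} [MetricSpace E] [CompleteSpace E]
    {F : ℕ → X → E} {s : Set X} {C : ℝ}
    (h : ∀ n, ∀ x ∈ s, dist (F n x) (F (n + 1) x) ≤ C * (1 / 2) ^ n) :
    ∃ G : X → E, TendstoUniformlyOn F G atTop s := by
  classical
  have hlim : ∀ x, ∃ y, x ∈ s → Tendsto (fun n => F n x) atTop (𝓝 y) := by
    intro x
    by_cases hx : x ∈ s
    · obtain ⟨y, hy⟩ := cauchySeq_tendsto_of_complete
        (cauchySeq_of_le_geometric (1 / 2) C (by norm_num) (fun n => h n x hx))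
      exact ⟨y, fun _ => hy⟩
    · exact ⟨F 0 x, fun hx' => absurd hx' hx⟩
  choose G hG using hlim
  refine ⟨G, Metric.tendstoUniformlyOn_iff.2 fun η hη => ?_⟩
  have ht : Tendsto (fun n : ℕ => C * (1 / 2 : ℝ) ^ n / (1 - 1 / 2)) atTop (𝓝 0) := by
    have := (tendsto_pow_atTop_nhds_zero_of_lt_one (r := (1 / 2 : ℝ)) (by norm_num)
      (by norm_num)).const_mul C
    simpa using this.div_const (1 - 1 / 2)
  filter_upwards [ht.eventually (gt_mem_nhds hη)] with n hn x hx
  rw [dist_comm]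
  exact (dist_le_of_le_geometric_of_tendsto (1 / 2) C (by norm_num) (fun n => h n x hx)
    (hG x hx) n).trans_lt hn

lemma Dense.exists_continuous_tendstoUniformlyOn {E : Type*} [MetricSpace E] [CompleteSpace E]
    {F : ℕ → E → E} {G : E → E} {s : Set E} (hs : Dense s) (h : TendstoUniformlyOn F G atTop s)
    (hF : ∀ n, UniformContinuousOn (F n) s) :
    ∃ S : E → E, Continuous S ∧ TendstoUniformlyOn F S atTop s := by
  have hG : UniformContinuousOn G s :=
    h.uniformContinuousOn (Eventually.frequently (Eventually.of_forall hF))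
  have hG' : UniformContinuous (s.domRestrict G) := uniformContinuousOn_iff_restrict.1 hG
  refine ⟨hs.extend (s.domRestrict G), (hs.uniformContinuous_extend hG').continuous,
    h.congr_right fun x hx => ?_⟩
  exact (hs.extend_of_ind hG' ⟨x, hx⟩).symm

/-- Uniform convergence of `Ψ` permits a moving argument: `Ψ n (F n w)` tends to `Φ (S w)`. Density
extends the identity from `s`. -/
lemma semiconj_of_tendstoUniformly {E : Type*} [MetricSpace E] {F Ψ C : ℕ → E → E}
    {S Φ R : E → E} {s : Set E} (hs : Dense s) (hF : TendstoUniformlyOn F S atTop s)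
    (hΨ : TendstoUniformly Ψ Φ atTop) (hC : TendstoUniformly C Φ atTop) (hΦ : Continuous Φ)
    (hS : Continuous S) (hR : Continuous R) (h : ∀ n, ∀ w ∈ s, Ψ n (F n w) = R (C n w)) (w : E) :
    Φ (S w) = R (Φ w) := by
  refine congrFun (Continuous.ext_on hs (hΦ.comp hS) (hR.comp hΦ) fun w hw => ?_) w
  have h1 : Tendsto (fun n => Ψ n (F n w)) atTop (𝓝 (Φ (S w))) :=
    hΨ.tendsto_comp hΦ.continuousAt (hF.tendsto_at hw)
  have h2 : Tendsto (fun n => R (C n w)) atTop (𝓝 (R (Φ w))) :=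
    (hR.tendsto _).comp (hC.tendsto_at w)
  exact tendsto_nhds_unique h1 (h2.congr fun n => (h n w hw).symm)

lemma surjective_of_tendstoUniformly {E : Type*} [MetricSpace E] [CompactSpace E]
    {F : ℕ → E → E} {Φ : E → E} (h : TendstoUniformly F Φ atTop) (hΦ : Continuous Φ)
    (hF : ∀ n, Function.Surjective (F n)) : Function.Surjective Φ := by
  intro y
  have hcl : IsClosed (range Φ) := (isCompact_range hΦ).isClosed
  rw [← mem_range, ← hcl.closure_eq, Metric.mem_closure_iff]
  intro η hη
  obtain ⟨n, hn⟩ := (Metric.tendstoUniformly_iff.1 h η hη).exists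
  obtain ⟨x, rfl⟩ := hF n y
  exact ⟨Φ x, mem_range_self x, by rw [dist_comm]; exact hn x⟩

section
variable {D : StripData} {α : ℕ → ℝ} {z : ℕ → Torus} {δ δ' : ℕ → ℝ}

/-! ### The infinite product -/

/-- Telescoping of `(r + 1)(r + 3)/(r + 2)^2`. -/
lemma prod_one_sub_inv_sq (n m : ℕ) (h : n ≤ m) :
    ∏ r ∈ Finset.Icc (n + 1) m, (1 - 1 / (((r + 2) ^ 2 : ℕ) : ℝ)) =
      (n + 2) / (n + 3) * ((m + 3) / (m + 2)) := by
  induction m, h using Nat.le_induction with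
  | base =>
    rw [Finset.Icc_eq_empty (by omega), Finset.prod_empty]
    field_simp
  | succ m h ih =>
    rw [Finset.prod_Icc_succ_top (by omega), ih]
    push_cast
    field_simp
    ring

lemma two_thirds_le_prod (n m : ℕ) (h : n ≤ m) :
    2 / 3 ≤ ∏ r ∈ Finset.Icc (n + 1) m, (1 - 1 / (((r + 2) ^ 2 : ℕ) : ℝ)) := by
  rw [prod_one_sub_inv_sq n m h]
  have h1 : (2 / 3 : ℝ) ≤ (n + 2) / (n + 3) := by
    rw [div_le_div_iff₀ (by norm_num) (by positivity)]
    linarith [(Nat.cast_nonneg n : (0 : ℝ) ≤ n)]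
  have h2 : (1 : ℝ) ≤ (m + 3) / (m + 2) := by
    rw [le_div_iff₀ (by positivity)]
    linarith
  have h3 := mul_le_mul h1 h2 zero_le_one (by positivity)
  linarith

lemma tendsto_prod_one_sub_inv_sq :
    Tendsto (fun N : ℕ => ∏ r ∈ Finset.Icc 1 N, (1 - 1 / (((r + 2) ^ 2 : ℕ) : ℝ))) atTop
      (𝓝 (2 / 3)) := by
  have h1 : Tendsto (fun N : ℕ => (2 / 3 : ℝ) * (1 + 1 / ((N : ℝ) + 2))) atTop
      (𝓝 (2 / 3 * (1 + 0))) := by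
    refine (tendsto_const_nhds.add ?_).const_mul _
    exact Tendsto.const_div_atTop
      (tendsto_atTop_add_const_right _ _ tendsto_natCast_atTop_atTop) _
  rw [add_zero, mul_one] at h1
  refine h1.congr fun N => ?_
  have h2 := prod_one_sub_inv_sq 0 N (Nat.zero_le N)
  rw [zero_add] at h2
  rw [h2]
  push_cast
  field_simp
  ring

/-! ### Separation of points -/

lemma prod_mul_flatDist_le {F : ℕ → Torus → Torus} {b : ℕ → ℝ} (hb : ∀ n, 0 ≤ 1 - b n)
    (h : ∀ n : ℕ, 1 ≤ n → ∀ v w : Torus, 1 / (n : ℝ) ≤ flatDist v w →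
      (1 - b (n + 1)) * flatDist (F n v) (F n w) ≤ flatDist (F (n + 1) v) (F (n + 1) w))
    {n m : ℕ} (hn : 1 ≤ n) (hm : n ≤ m) {v w : Torus} (hvw : 1 / (n : ℝ) ≤ flatDist v w) :
    (∏ r ∈ Finset.Icc (n + 1) m, (1 - b r)) * flatDist (F n v) (F n w) ≤
      flatDist (F m v) (F m w) := by
  induction m, hm using Nat.le_induction with
  | base => rw [Finset.Icc_eq_empty (by omega), Finset.prod_empty, one_mul]
  | succ m hm ih =>
    rw [Finset.prod_Icc_succ_top (by omega), mul_comm _ (1 - b (m + 1)), mul_assoc]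
    refine (mul_le_mul_of_nonneg_left ih (hb _)).trans (h m (hn.trans hm) v w (le_trans ?_ hvw))
    exact one_div_le_one_div_of_le (by exact_mod_cast hn) (by exact_mod_cast hm)

/-- If the maps `F n` separate distant points well, points that have the same limit are
identified by some `F n`. -/
lemma exists_eq_of_limit_eq {F : ℕ → Torus → Torus} {Φ : Torus → Torus}
    (hF : TendstoUniformly F Φ atTop) {C : ℝ} (hC : 0 < C)
    (h : ∀ n m : ℕ, 1 ≤ n → n < m → ∀ v w : Torus, 1 / (n : ℝ) ≤ flatDist v w →
      C * flatDist (F n v) (F n w) ≤ flatDist (F m v) (F m w))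
    {v w : Torus} (hvw : v ≠ w) (he : Φ v = Φ w) : ∃ n, F n v = F n w := by
  -- From stage `N + 1` on, the separation bound applies to this pair, so distinct images at that
  -- stage would force distinct limits.
  obtain ⟨N, hN⟩ := exists_nat_one_div_lt (flatDist_pos hvw)
  refine ⟨N + 1, ?_⟩
  by_contra hne
  have hpos := mul_pos hC (flatDist_pos hne)
  have hlim : Tendsto (fun m => flatDist (F m v) (F m w)) atTop (𝓝 (flatDist (Φ v) (Φ w))) :=
    Tendsto.comp (g := fun p : Torus × Torus => flatDist p.1 p.2) (f := fun m => (F m v, F m w))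
      (continuous_flatDist.tendsto (Φ v, Φ w))
      ((hF.tendsto_at v).prodMk_nhds (hF.tendsto_at w))
  have hN' : 1 / ((N + 1 : ℕ) : ℝ) ≤ flatDist v w := by
    rw [Nat.cast_add_one]
    exact hN.le
  have hle : C * flatDist (F (N + 1) v) (F (N + 1) w) ≤ flatDist (Φ v) (Φ w) := by
    refine ge_of_tendsto hlim ?_
    filter_upwards [eventually_gt_atTop (N + 1)] with m hm
    exact h (N + 1) m (Nat.le_add_left 1 N) hm v w hN'
  rw [he, flatDist_self] at hle
  linarith

/-- The first coordinates of the centres `z n` are well separated in relation to the sizes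
`δ n`. -/
def Separated (z : ℕ → Torus) (δ : ℕ → ℝ) : Prop :=
  ∀ n, ∀ j ≤ n + 3, j ≠ n → 4 * δ n ≤ ‖(z n).1 - (z j).1‖

lemma lam_comm (hα : ∀ k, α k ∈ Icc (0 : ℝ) 1) (hδ : SmallSizes δ) (hsep : Separated z δ) (j k : ℕ)
    (hjk : j ≤ k + 3) (hkj : k ≤ j + 3) (w : Torus) :
    lam D α (z j) (δ j) (lam D α (z k) (δ k) w) = lam D α (z k) (δ k) (lam D α (z j) (δ j) w) := by
  rcases eq_or_ne j k with rfl | hne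
  · rfl
  by_cases hj : δ j ≤ ‖w.1 - (z j).1‖
  · rw [lam_of_le_norm (w := w) hα (hδ j).1 (hδ j).2 hj,
      lam_of_le_norm hα (hδ j).1 (hδ j).2 (by rwa [lam_fst])]
  by_cases hk : δ k ≤ ‖w.1 - (z k).1‖
  · rw [lam_of_le_norm (w := w) hα (hδ k).1 (hδ k).2 hk,
      lam_of_le_norm hα (hδ k).1 (hδ k).2 (by rwa [lam_fst])]
  have h1 := hsep j k hkj hne.symm
  have h2 := hsep k j hjk hne
  rw [norm_sub_rev] at h2
  have h3 := norm_sub_le_norm_sub_add_norm_sub (z j).1 w.1 (z k).1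
  rw [norm_sub_rev (z j).1 w.1] at h3
  linarith [(hδ j).1, (hδ k).1]

lemma exists_lamComp_eq_center (hα : ∀ k, α k ∈ Icc (0 : ℝ) 1) (hδ : SmallSizes δ) {N : ℕ}
    {v w : Torus} (hvw : v ≠ w) (h : lamComp D α z δ N v = lamComp D α z δ N w) :
    ∃ n, lamComp D α z δ (n + 1) v = z n := by
  induction N with
  | zero => exact absurd h hvw
  | succ N ih =>
    by_cases he : lamComp D α z δ N v = lamComp D α z δ N w
    · exact ih he
    · exact ⟨N, lam_collapse hα (hδ N).1 (hδ N).2 he h⟩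

/-- Every later strip misses column `n`, so an orbit that reaches `z n` at stage `n + 1` stays
there. -/
lemma limit_eq_center (hα : ∀ k, α k ∈ Icc (0 : ℝ) 1) (hδ : SmallSizes δ) (hsep : Separated z δ)
    {w y : Torus} {n : ℕ} (h : lamComp D α z δ (n + 1) w = z n)
    (hlim : Tendsto (fun m => lamComp D α z δ (m + 1) w) atTop (𝓝 y)) : y = z n := by
  have hconst : ∀ m, n + 1 ≤ m → lamComp D α z δ m w = z n := by
    intro m hm
    induction m, hm using Nat.le_induction with
    | base => exact h
    | succ m hm ih =>
      rw [lamComp_succ, ih]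
      refine lam_of_le_norm hα (hδ m).1 (hδ m).2 ?_
      have := hsep m n (by omega) (by omega)
      rw [norm_sub_rev]
      linarith [(hδ m).1]
  refine tendsto_nhds_unique hlim (tendsto_const_nhds.congr' ?_)
  filter_upwards [eventually_ge_atTop n] with m hm
  exact (hconst (m + 1) (by omega)).symm

lemma exists_ne_lamComp_eq_center (hα : ∀ k, α k ∈ Icc (0 : ℝ) 1) (hδ : SmallSizes δ) (n : ℕ) :
    ∃ v w : Torus, v ≠ w ∧ lamComp D α z δ (n + 1) v = z n ∧
      lamComp D α z δ (n + 1) w = z n := by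
  obtain ⟨V, W, -, -, hne, hV, hW⟩ := exists_ne_lam_eq (D := D) hα (hδ n).1 (hδ n).2 (z n)
  obtain ⟨v, -, rfl⟩ := exists_lamComp_eq (D := D) (z := z) hα hδ n V
  obtain ⟨w, -, rfl⟩ := exists_lamComp_eq (D := D) (z := z) hα hδ n W
  exact ⟨v, w, fun e => hne (by rw [e]), hV, hW⟩

/-! ### The conjugated maps -/

lemma conjOn_uniformContinuousOn (hα : ∀ k, α k ∈ Icc (0 : ℝ) 1) {e : Torus} {X : Set Torus}
    {R : Torus → Torus} (hX : ∀ w ∈ X, ∀ k, w.1 ≠ (z k).1) (hR : ∀ w, R w = w + e)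
    (hRX : MapsTo R X X) (hδ : SmallSizes δ) (hδ' : SmallSizes δ')
    (hgap : ∀ n, ∀ k < n, 4 * δ n ≤ ‖(z n).1 - (z k).1‖)
    (hgap' : ∀ n, ∀ k < n, 4 * δ' n ≤ ‖(z n).1 - (z k).1‖) {n : ℕ}
    (hΨ : BijOn (lamComp D α (fun k => z k + e) δ' n) X X) (hC : BijOn (lamComp D α z δ n) X X) :
    UniformContinuousOn
      (conjOn X (lamComp D α (fun k => z k + e) δ' n) R (lamComp D α z δ n)) X := by
  refine Metric.uniformContinuousOn_iff.2 fun η hη => ?_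
  obtain ⟨κ, hκ, h⟩ := conj_equicontinuous (D := D) hα e hδ hδ' hgap hgap' n hη
  refine ⟨κ, hκ, fun V hV W hW hVW => h V W _ _ (hX V hV) (hX W hW) ?_ ?_ hVW⟩
  · rw [← hR]
    exact (conjOn_spec hΨ hC.mapsTo hRX hV).2
  · rw [← hR]
    exact (conjOn_spec hΨ hC.mapsTo hRX hW).2

/-! ### The size of a square -/

lemma flatDist_le_one (v w : Torus) : flatDist v w ≤ 1 := by
  have h : dist v w ≤ 1 / 2 := by
    rw [Prod.dist_eq, dist_eq_norm, dist_eq_norm]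
    exact max_le (norm_le_half _) (norm_le_half _)
  linarith [flatDist_le_two_mul_dist v w]

/-- The square contains two points at distance `min s (1/4)`. The cap avoids wrapping around the
torus, and `ε ≤ 1/4` rules out large `s`. -/
lemma lt_of_flatDiam_square_lt {x : Torus} {s ε : ℝ} (hs : 0 < s) (hε : ε ≤ 1 / 4)
    (h : flatDiam (square x s) < ε) : s < ε := by
  set t := min s (1 / 4) with ht
  have ht0 : 0 < t := lt_min hs (by norm_num)
  have hts : t ≤ s := min_le_left _ _
  have ht4 : t ≤ 1 / 4 := min_le_right _ _
  have hnorm : ‖(t : UnitAddCircle)‖ = t := by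
    rw [norm_coe_of_abs_le (by rw [abs_of_pos ht0]; linarith), abs_of_pos ht0]
  have hle : t ≤ flatDiam (square x s) := by
    have h1 : t ≤ flatDist (x.1 + (t : UnitAddCircle), x.2) x := by
      refine le_trans ?_ (dist_le_flatDist _ _)
      refine le_trans ?_ (le_max_left _ _)
      rw [dist_eq_norm, add_sub_cancel_left, hnorm]
    refine h1.trans (le_csSup ?_ ⟨_, ?_, _, ?_, rfl⟩)
    · refine ⟨1, ?_⟩
      rintro r ⟨v, -, w, -, rfl⟩
      exact flatDist_le_one v w
    · rw [mem_square]
      simpa [hnorm] using ⟨hts, hs.le⟩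
    · rw [mem_square]
      simpa using hs.le
  rcases min_choice s (1 / 4) with e | e <;> rw [← ht] at e <;> linarith

end

/-! ### Passing to the limit in the conjugated maps. -/

section
variable {D : StripData} {α : ℕ → ℝ} {z : ℕ → Torus} {δ δ' : ℕ → ℝ}

lemma dist_conjOn_succ_le {e : Torus} {X : Set Torus} {R : Torus → Torus}
    (hX : ∀ w ∈ X, ∀ k, w.1 ≠ (z k).1) (hR : ∀ w, R w = w + e) (hRX : MapsTo R X X)
    (hΨ : ∀ n, BijOn (lamComp D α (fun k => z k + e) δ' n) X X)
    (hC : ∀ n, BijOn (lamComp D α z δ n) X X) {n : ℕ} {η : ℝ}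
    (h : ∀ w A B : Torus, (∀ k, w.1 ≠ (z k).1) →
      lamComp D α (fun k => z k + e) δ' n A = lamComp D α z δ n w + e →
      lamComp D α (fun k => z k + e) δ' (n + 1) B = lamComp D α z δ (n + 1) w + e →
      dist A B < η) {w : Torus} (hw : w ∈ X) :
    dist (conjOn X (lamComp D α (fun k => z k + e) δ' n) R (lamComp D α z δ n) w)
      (conjOn X (lamComp D α (fun k => z k + e) δ' (n + 1)) R (lamComp D α z δ (n + 1)) w) ≤ η := by
  refine (h w _ _ (hX w hw) ?_ ?_).le
  · rw [← hR]
    exact (conjOn_spec (hΨ n) (hC n).mapsTo hRX hw).2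
  · rw [← hR]
    exact (conjOn_spec (hΨ (n + 1)) (hC (n + 1)).mapsTo hRX hw).2

/-- The construction of the homeomorphism `S` from the two sequences of conjugated maps. -/
lemma existsUnique_homeomorph {X : Set Torus} (hXd : Dense X)
    (hXc : ∀ v w : Torus, v.1 = w.1 → v ∈ X → w ∈ X) {c : Torus} (hRX : MapsTo (rot c) X X)
    (hRX' : MapsTo (rot c).symm X X) {Φ : Torus → Torus} {C Ψ Ψ' : ℕ → Torus → Torus}
    (hΦ : Continuous Φ) (hfst : ∀ w, (Φ w).1 = w.1) (hbij : BijOn Φ X X)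
    (hCΦ : TendstoUniformly C Φ atTop) (hΨΦ : TendstoUniformly Ψ Φ atTop)
    (hΨΦ' : TendstoUniformly Ψ' Φ atTop) (hC : ∀ n, BijOn (C n) X X)
    (hΨ : ∀ n, BijOn (Ψ n) X X) (hΨ' : ∀ n, BijOn (Ψ' n) X X)
    (hF : ∀ n, UniformContinuousOn (conjOn X (Ψ n) (rot c) (C n)) X)
    (hF' : ∀ n, UniformContinuousOn (conjOn X (Ψ' n) (rot c).symm (C n)) X)
    {G G' : Torus → Torus}
    (hG : TendstoUniformlyOn (fun n => conjOn X (Ψ n) (rot c) (C n)) G atTop X)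
    (hG' : TendstoUniformlyOn (fun n => conjOn X (Ψ' n) (rot c).symm (C n)) G' atTop X) :
    ∃! S : Torus ≃ₜ Torus, (∀ w ∈ X, S w = conjOn X Φ (rot c) Φ w) ∧
      (∀ w, Φ (S w) = rot c (Φ w)) ∧
      TendstoUniformlyOn (fun n => conjOn X (Ψ n) (rot c) (C n)) S atTop X ∧
      TendstoUniformlyOn (fun n => conjOn X (Ψ' n) (rot c).symm (C n)) S.symm atTop X := by
  obtain ⟨S, hSc, hS⟩ := Dense.exists_continuous_tendstoUniformlyOn hXd hG hF
  obtain ⟨S', hSc', hS'⟩ := Dense.exists_continuous_tendstoUniformlyOn hXd hG' hF'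
  have hsemi : ∀ w, Φ (S w) = rot c (Φ w) :=
    semiconj_of_tendstoUniformly hXd hS hΨΦ hCΦ hΦ hSc (rot c).continuous
      fun n w hw => (conjOn_spec (hΨ n) (hC n).mapsTo hRX hw).2
  have hsemi' : ∀ w, Φ (S' w) = (rot c).symm (Φ w) :=
    semiconj_of_tendstoUniformly hXd hS' hΨΦ' hCΦ hΦ hSc' (rot c).symm.continuous
      fun n w hw => (conjOn_spec (hΨ' n) (hC n).mapsTo hRX' hw).2
  have hSX : MapsTo S X X := fun w hw => by
    refine hXc _ _ ?_ (hRX (hbij.mapsTo hw))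
    rw [← hsemi, hfst]
  have hSX' : MapsTo S' X X := fun w hw => by
    refine hXc _ _ ?_ (hRX' (hbij.mapsTo hw))
    rw [← hsemi', hfst]
  -- On `X` both `S' (S w)` and `w` lie in `X` and have the same image under `Φ`, which is injective
  -- there; density does the rest.
  have hleft : Function.LeftInverse S' S := fun w =>
    congrFun (Continuous.ext_on hXd (hSc'.comp hSc) continuous_id fun w hw =>
      hbij.injOn (hSX' (hSX hw)) hw
        ((hsemi' _).trans (by rw [hsemi, Homeomorph.symm_apply_apply]; rfl))) w
  have hright : Function.RightInverse S' S := fun w =>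
    congrFun (Continuous.ext_on hXd (hSc.comp hSc') continuous_id fun w hw =>
      hbij.injOn (hSX (hSX' hw)) hw
        ((hsemi _).trans (by rw [hsemi', Homeomorph.apply_symm_apply]; rfl))) w
  have hconj : ∀ w ∈ X, S w = conjOn X Φ (rot c) Φ w := fun w hw => by
    obtain ⟨h1, h2⟩ := conjOn_spec hbij hbij.mapsTo hRX hw
    exact hbij.injOn (hSX hw) h1 (by rw [h2, hsemi])
  refine ⟨⟨⟨S, S', hleft, hright⟩, hSc, hSc'⟩, ⟨hconj, hsemi, hS, hS'⟩, ?_⟩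
  rintro S₁ ⟨h₁, -⟩
  refine Homeomorph.ext fun w => ?_
  exact congrFun (Continuous.ext_on hXd S₁.continuous hSc fun w hw =>
    (h₁ w hw).trans (hconj w hw).symm) w

lemma tendstoUniformly_of_dist_le {E : Type*} [MetricSpace E] {F F' : ℕ → E → E} {Φ : E → E}
    (hF : TendstoUniformly F Φ atTop) {C : ℝ} {N : ℕ}
    (h : ∀ n w, dist (F' (n + N) w) (F (n + N) w) ≤ C * (1 / 2) ^ n) :
    TendstoUniformly F' Φ atTop := by
  refine Metric.tendstoUniformly_iff.2 fun η hη => ?_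
  have ht : Tendsto (fun n : ℕ => C * (1 / 2 : ℝ) ^ n) atTop (𝓝 0) := by
    simpa using (tendsto_pow_atTop_nhds_zero_of_lt_one (r := (1 / 2 : ℝ)) (by norm_num)
      (by norm_num)).const_mul C
  have h1 := (tendsto_sub_atTop_nat N).eventually (ht.eventually (gt_mem_nhds (half_pos hη)))
  filter_upwards [h1, Metric.tendstoUniformly_iff.1 hF _ (half_pos hη), eventually_ge_atTop N]
    with n hn hn' hN w
  have h2 := h (n - N) w
  rw [Nat.sub_add_cancel hN] at h2
  have h3 := dist_triangle_right (Φ w) (F' n w) (F n w)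
  linarith [hn' w]

end

end DenjoyRees
end

/-! ### Choice of the thresholds and assembly of the theorem. -/

open DenjoyRees
theorem mainTheorem4
    (c z₀ : Torus) (hT : IsMinimalHomeo (rot c))
    (D : StripData) (α : ℕ → ℝ) (hα : ∀ k, α k ∈ Set.Icc (0 : ℝ) 1) :
    ∃ (a : ℕ → ℕ) (ε₁ ε₂ ε₃ : ℕ → ℝ),
      (∀ n, 2 ≤ a n) ∧
      (∃ P : ℝ, 0 < P ∧
        Tendsto (fun N : ℕ => ∏ r ∈ Finset.Icc 1 N, (1 - 1 / (a r : ℝ))) atTop (𝓝 P)) ∧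
      (∀ n, 0 < ε₁ n ∧ 0 < ε₂ n ∧ 0 < ε₃ n) ∧
      ∀ δ : ℕ → ℝ, (∀ n, 0 < δ n) →
        (∀ n, flatDiam (square (orbitPt c z₀ n) (δ n)) < ε₁ n ∧
          flatDiam (square (orbitPt c z₀ n) (δ n)) < ε₂ n ∧
          flatDiam (square (orbitPt c z₀ n) (δ n)) < ε₃ n) →
        -- the lower bound on the separation of points
        (∀ n m : ℕ, 1 ≤ n → n < m → ∀ v w : Torus, 1 / (n : ℝ) ≤ flatDist v w →
          (∏ r ∈ Finset.Icc (n + 1) m, (1 - 1 / (a r : ℝ))) *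
              flatDist (phi D α c z₀ δ n v) (phi D α c z₀ δ n w) ≤
            flatDist (phi D α c z₀ δ m v) (phi D α c z₀ δ m w)) ∧
        -- the maps that are inverted below are bijections of `X`
        (∀ n, Set.BijOn (phi D α c z₀ δ n) (goodSet c z₀) (goodSet c z₀) ∧
          Set.BijOn (phiSigma D α c z₀ δ n) (goodSet c z₀) (goodSet c z₀) ∧
          Set.BijOn (phiTau D α c z₀ δ n) (goodSet c z₀) (goodSet c z₀)) ∧
        -- the conjugated maps are uniformly continuous and uniformly Cauchy on `X`
        (∀ n, UniformContinuousOn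
          (conjOn (goodSet c z₀) (phiSigma D α c z₀ δ n) (rot c) (phi D α c z₀ δ n))
          (goodSet c z₀)) ∧
        (∀ n, UniformContinuousOn
          (conjOn (goodSet c z₀) (phiTau D α c z₀ δ n) (rot c).symm (phi D α c z₀ δ n))
          (goodSet c z₀)) ∧
        UniformCauchySeqOn
          (fun n => conjOn (goodSet c z₀) (phiSigma D α c z₀ δ n) (rot c) (phi D α c z₀ δ n))
          atTop (goodSet c z₀) ∧
        UniformCauchySeqOn
          (fun n => conjOn (goodSet c z₀) (phiTau D α c z₀ δ n) (rot c).symm (phi D α c z₀ δ n))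
          atTop (goodSet c z₀) ∧
        -- the limit `Φ` and the homeomorphism `S`
        ∃ Φ : Torus → Torus,
          TendstoUniformly (phi D α c z₀ δ) Φ atTop ∧
          Continuous Φ ∧ Function.Surjective Φ ∧ (∀ w, (Φ w).1 = w.1) ∧
          Set.BijOn Φ (goodSet c z₀) (goodSet c z₀) ∧
          (∀ z : Torus, (¬ ∃! w, Φ w = z) ↔ ∃ n, z = orbitPt c z₀ n) ∧
          ∃! S : Torus ≃ₜ Torus,
            (∀ w ∈ goodSet c z₀, S w = conjOn (goodSet c z₀) Φ (rot c) Φ w) ∧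
            (∀ w, Φ (S w) = rot c (Φ w)) ∧
            TendstoUniformlyOn
              (fun n => conjOn (goodSet c z₀) (phiSigma D α c z₀ δ n) (rot c) (phi D α c z₀ δ n))
              S atTop (goodSet c z₀) ∧
            TendstoUniformlyOn
              (fun n => conjOn (goodSet c z₀) (phiTau D α c z₀ δ n) (rot c).symm
                (phi D α c z₀ δ n))
              S.symm atTop (goodSet c z₀) := by
  have hz := orbitPt_fst_injective hT z₀
  set z := orbitPt c z₀
  have hzσ : (fun k => z k + c) = fun k => z (sigma k) := funext fun k => rot_orbitPt c z₀ k
  have hzτ : (fun k => z k + -c) = fun k => z (tau k) := funext fun k => rot_symm_orbitPt c z₀ k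
  -- Indices below `n + 4` are those allowed in `Separated`; the slack of `3` covers the
  -- commutations and the displacement by `σ` and `τ`.
  choose g hg hgap using fun n => exists_gap z (z n).1 (n + 4)
  choose e₁ he₁ hstep using fun n => exists_separation_threshold (D := D) hα hz n
    (s := 1 / ((n : ℝ) + 1)) (b := 1 / (((n + 2) ^ 2 : ℕ) : ℝ)) (by positivity) (by positivity)
  choose e₂ he₂ hcσ using fun n => exists_cauchy_threshold (D := D) hα hz c n
    (show (0 : ℝ) < (1 / 2) ^ n by positivity)
  choose e₃ he₃ hcτ using fun n => exists_cauchy_threshold (D := D) hα hz (-c) n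
    (show (0 : ℝ) < (1 / 2) ^ n by positivity)
  -- Stage `n` of `Φ^σ` uses the size `δ (sigma n)`, which must lie below `e₂ n`; for the square `n`
  -- this is a bound by `e₂ (tau n)`, and symmetrically by `e₃ (sigma n)`.
  obtain ⟨ε, hε⟩ : ∃ ε : ℕ → ℝ, ∀ n, 0 < ε n ∧ ε n ≤ 1 / 4 ∧ ε n ≤ (1 / 2) ^ n / 2 ∧
      ε n ≤ g n / 4 ∧ ε n ≤ e₁ n ∧ (ε n ≤ e₂ n ∧ ε n ≤ e₂ (tau n)) ∧ ε n ≤ e₃ n ∧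
      ε n ≤ e₃ (sigma n) := by
    refine ⟨fun n => min (1 / 4) (min ((1 / 2) ^ n / 2) (min (g n / 4) (min (e₁ n)
      (min (min (e₂ n) (e₂ (tau n))) (min (e₃ n) (e₃ (sigma n))))))), fun n => ⟨?_, ?_⟩⟩
    · have := hg n
      have := he₁ n
      have := he₂ n
      have := he₂ (tau n)
      have := he₃ n
      have := he₃ (sigma n)
      positivity
    · simp only [← le_min_iff, le_refl]
  refine ⟨fun n => (n + 2) ^ 2, ε, ε, ε, fun n =>
    (Nat.le_add_left 2 n).trans (Nat.le_self_pow two_ne_zero _),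
    ⟨2 / 3, by norm_num, tendsto_prod_one_sub_inv_sq⟩,
    fun n => ⟨(hε n).1, (hε n).1, (hε n).1⟩, fun δ hδ0 hdiam => ?_⟩
  have hlt : ∀ n, δ n < ε n := fun n =>
    lt_of_flatDiam_square_lt (hδ0 n) (hε n).2.1 (hdiam n).1
  have hδ : SmallSizes δ := fun n => ⟨hδ0 n, (hlt n).le.trans (hε n).2.1⟩
  have hδσ : SmallSizes fun n => δ (sigma n) := fun n => hδ (sigma n)
  have hδτ : SmallSizes fun n => δ (tau n) := fun n => hδ (tau n)
  have hsep : Separated z δ := fun n j hj hne => by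
    have := hgap n j (by omega) fun e => hne (hz e).symm
    linarith [hlt n, (hε n).2.2.2.1]
  have hgapδ : ∀ n, ∀ k < n, 4 * δ n ≤ ‖(z n).1 - (z k).1‖ := fun n k hk =>
    hsep n k (by omega) (by omega)
  -- Translation by `c` turns columns `n`, `k` into columns `σ n`, `σ k`, where `σ k` can exceed `σ
  -- n` by `3`.
  have hgapσ : ∀ n, ∀ k < n, 4 * δ (sigma n) ≤ ‖(z n).1 - (z k).1‖ := fun n k hk => by
    have h := hsep (sigma n) (sigma k) (sigma_le_sigma_add hk) fun e => by
      have := congrArg tau e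
      rw [tau_sigma, tau_sigma] at this
      omega
    rw [← congrFun hzσ n, ← congrFun hzσ k] at h
    simpa using h
  have hgapτ : ∀ n, ∀ k < n, 4 * δ (tau n) ≤ ‖(z n).1 - (z k).1‖ := fun n k hk => by
    have h := hsep (tau n) (tau k) (tau_le_tau_add hk) fun e => by
      have := congrArg sigma e
      rw [sigma_tau, sigma_tau] at this
      omega
    rw [← congrFun hzτ n, ← congrFun hzτ k] at h
    simpa using h
  have hphi : phi D α c z₀ δ = fun n => lamComp D α z δ (n + 1) :=
    funext fun n => compUpTo_eq _ n
  have hphiσ : phiSigma D α c z₀ δ =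
      fun n => lamComp D α (fun k => z k + c) (fun k => δ (sigma k)) (n + 1) := by
    rw [hzσ]
    exact funext fun n => compUpTo_eq _ n
  have hphiτ : phiTau D α c z₀ δ =
      fun n => lamComp D α (fun k => z k + -c) (fun k => δ (tau k)) (n + 1) := by
    rw [hzτ]
    exact funext fun n => compUpTo_eq _ n
  set X := goodSet c z₀
  have hX : ∀ w ∈ X, ∀ k, w.1 ≠ (z k).1 := fun w hw k => hw k
  have hXc : ∀ v w : Torus, v.1 = w.1 → v ∈ X → w ∈ X := fun v w => goodSet_congr c z₀
  have hRX : MapsTo (rot c) X X := fun w hw => rot_mem_goodSet hw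
  have hRX' : MapsTo (rot c).symm X X := fun w hw => rot_symm_mem_goodSet hw
  have bC : ∀ n, BijOn (lamComp D α z δ n) X X := fun n => lamComp_bijOn hα hδ n hX hXc
  have bσ : ∀ n, BijOn (lamComp D α (fun k => z k + c) (fun k => δ (sigma k)) n) X X :=
    fun n => lamComp_bijOn hα hδσ n (fun w hw k => by
      rw [congrFun hzσ k]
      exact hX w hw _) hXc
  have bτ : ∀ n, BijOn (lamComp D α (fun k => z k + -c) (fun k => δ (tau k)) n) X X :=
    fun n => lamComp_bijOn hα hδτ n (fun w hw k => by
      rw [congrFun hzτ k]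
      exact hX w hw _) hXc
  have ucσ := fun n => conjOn_uniformContinuousOn hα hX (rot_apply c) hRX hδ hδσ hgapδ hgapσ
    (bσ (n + 1)) (bC (n + 1))
  have ucτ := fun n => conjOn_uniformContinuousOn hα hX (rot_symm_apply c) hRX' hδ hδτ hgapδ hgapτ
    (bτ (n + 1)) (bC (n + 1))
  obtain ⟨G, hG⟩ := exists_tendstoUniformlyOn (C := 1 / 2) (s := X)
    (F := fun n => conjOn X (lamComp D α (fun k => z k + c) (fun k => δ (sigma k)) (n + 1)) (rot c)
      (lamComp D α z δ (n + 1))) fun n w hw => by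
    rw [← pow_succ']
    refine dist_conjOn_succ_le hX (rot_apply c) hRX bσ bC (hcσ (n + 1) δ _ hδ hδσ ?_ ?_) hw
    · exact (hlt _).trans_le (hε _).2.2.2.2.2.1.1
    · have := (hε (sigma (n + 1))).2.2.2.2.2.1.2
      rw [tau_sigma] at this
      exact (hlt _).trans_le this
  obtain ⟨G', hG'⟩ := exists_tendstoUniformlyOn (C := 1 / 2) (s := X)
    (F := fun n => conjOn X (lamComp D α (fun k => z k + -c) (fun k => δ (tau k)) (n + 1))
      (rot c).symm (lamComp D α z δ (n + 1))) fun n w hw => by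
    rw [← pow_succ']
    refine dist_conjOn_succ_le hX (rot_symm_apply c) hRX' bτ bC
      (hcτ (n + 1) δ _ hδ hδτ ?_ ?_) hw
    · exact (hlt _).trans_le (hε _).2.2.2.2.2.2.1
    · have := (hε (tau (n + 1))).2.2.2.2.2.2.2
      rw [sigma_tau] at this
      exact (hlt _).trans_le this
  have hmove : ∀ n w, dist (lam D α (z n) (δ n) w) w ≤ (1 / 2) ^ n := fun n w =>
    (dist_lam_self_le hα hδ n (z n) w).trans (by linarith [hlt n, (hε n).2.2.1])
  obtain ⟨Φ, hΦ⟩ := exists_tendstoUniformlyOn (C := 1 / 2) (s := univ)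
    (F := fun n => lamComp D α z δ (n + 1)) fun n w _ => by
    rw [dist_comm, ← pow_succ']
    exact hmove (n + 1) _
  rw [tendstoUniformlyOn_univ] at hΦ
  have hsepar : ∀ n m : ℕ, 1 ≤ n → n < m → ∀ v w : Torus, 1 / (n : ℝ) ≤ flatDist v w →
      (∏ r ∈ Finset.Icc (n + 1) m, (1 - 1 / (((r + 2) ^ 2 : ℕ) : ℝ))) *
        flatDist (lamComp D α z δ (n + 1) v) (lamComp D α z δ (n + 1) w) ≤
      flatDist (lamComp D α z δ (m + 1) v) (lamComp D α z δ (m + 1) w) := by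
    intro n m hn hm v w hvw
    refine prod_mul_flatDist_le (F := fun n => lamComp D α z δ (n + 1))
      (b := fun r => 1 / (((r + 2) ^ 2 : ℕ) : ℝ)) (fun r => ?_) (fun n hn v w hvw => ?_) hn hm.le
      hvw
    · have : (1 : ℝ) ≤ (((r + 2) ^ 2 : ℕ) : ℝ) := by
        exact_mod_cast Nat.one_le_pow _ _ (by omega)
      rw [sub_nonneg]
      exact div_le_one_of_le₀ this (by positivity)
    -- Passing from `Φ_n` to `Φ_{n+1}` applies the square of index `n + 1`, whose threshold covers
    -- all distances from `1/(n+2)` on.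
    · refine hstep (n + 1) δ hδ ((hlt _).trans_le (hε _).2.2.2.2.1) v w (le_trans ?_ hvw)
      refine one_div_le_one_div_of_le (by exact_mod_cast hn) ?_
      push_cast
      linarith
  have hΦc : Continuous Φ := hΦ.continuous
    (Eventually.frequently (Eventually.of_forall fun n => lamComp_continuous hα hδ (n + 1)))
  have hΦfst : ∀ w, (Φ w).1 = w.1 := fun w => by
    have h := (continuous_fst.tendsto (Φ w)).comp (hΦ.tendsto_at w)
    exact tendsto_nhds_unique h (tendsto_const_nhds.congr fun n => (lamComp_fst (n + 1) w).symm)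
  have hΦs : Function.Surjective Φ := surjective_of_tendstoUniformly hΦ hΦc fun n w => by
    obtain ⟨v, -, hv⟩ := exists_lamComp_eq (D := D) (z := z) hα hδ (n + 1) w
    exact ⟨v, hv⟩
  have hcoll : ∀ v w, v ≠ w → Φ v = Φ w → ∃ n, Φ v = z n := by
    intro v w hvw he
    obtain ⟨N, hN⟩ := exists_eq_of_limit_eq hΦ (C := 2 / 3) (by norm_num)
      (fun n m hn hm v w hvw => le_trans (mul_le_mul_of_nonneg_right
        (two_thirds_le_prod n m hm.le) (flatDist_nonneg _ _)) (hsepar n m hn hm v w hvw)) hvw he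
    obtain ⟨n, hn⟩ := exists_lamComp_eq_center hα hδ hvw hN
    exact ⟨n, limit_eq_center hα hδ hsep hn (hΦ.tendsto_at v)⟩
  have hbij : BijOn Φ X X := by
    refine ⟨fun w hw => hXc w _ (hΦfst w).symm hw, fun v hv w _ he => ?_, fun w hw => ?_⟩
    · by_contra hvw
      obtain ⟨n, hn⟩ := hcoll v w hvw he
      exact hX v hv n (by rw [← hΦfst v, hn])
    · obtain ⟨v, rfl⟩ := hΦs w
      exact ⟨v, hXc _ _ (hΦfst v) hw, rfl⟩
  have hfibre : ∀ y : Torus, (¬ ∃! w, Φ w = y) ↔ ∃ n, y = z n := by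
    intro y
    constructor
    · intro h
      obtain ⟨v, rfl⟩ := hΦs y
      by_contra hne
      refine h ⟨v, rfl, fun w hw => ?_⟩
      by_contra hvw
      obtain ⟨n, hn⟩ := hcoll w v hvw hw
      exact hne ⟨n, hw.symm.trans hn⟩
    · rintro ⟨n, rfl⟩ ⟨u, -, hu⟩
      obtain ⟨v, w, hne, hv, hw⟩ := exists_ne_lamComp_eq_center (D := D) (z := z) hα hδ n
      exact hne ((hu v (limit_eq_center hα hδ hsep hv (hΦ.tendsto_at v))).trans
        (hu w (limit_eq_center hα hδ hsep hw (hΦ.tendsto_at w))).symm)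
  have hcomm := lam_comm (D := D) hα hδ hsep
  have hΦσ : TendstoUniformly (phiSigma D α c z₀ δ) Φ atTop := by
    refine tendstoUniformly_of_dist_le (F := phi D α c z₀ δ) (by rwa [hphi]) (C := 4) (N := 1)
      fun n w => ?_
    exact dist_compUpTo_sigma_le (L := fun k => lam D α (z k) (δ k)) hcomm hmove n w
  have hΦτ : TendstoUniformly (phiTau D α c z₀ δ) Φ atTop := by
    refine tendstoUniformly_of_dist_le (F := phi D α c z₀ δ) (by rwa [hphi]) (C := 4) (N := 2)
      fun n w => ?_
    exact dist_compUpTo_tau_le (L := fun k => lam D α (z k) (δ k)) hcomm hmove n w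
  rw [hphiσ] at hΦσ
  rw [hphiτ] at hΦτ
  rw [hphi, hphiσ, hphiτ]
  refine ⟨hsepar, fun n => ⟨bC _, bσ _, bτ _⟩, ucσ, ucτ, hG.uniformCauchySeqOn,
    hG'.uniformCauchySeqOn, Φ, hΦ, hΦc, hΦs, hΦfst, hbij, hfibre, ?_⟩
  exact existsUnique_homeomorph (dense_goodSet c z₀) hXc hRX hRX' hΦc hΦfst hbij hΦ hΦσ hΦτ
    (fun n => bC _) (fun n => bσ _) (fun n => bτ _) ucσ ucτ hG hG'
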